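/- Let $n\ge 1$, let $U\subset\mathbb R$ be an open interval, and let $\mu$ be a Borel measure on $\mathbb R$ which is $(C,\alpha)$-Ahlfors regular for some $C>1$, $\alpha>0$: there is $\rho_0>0$ such that $C^{-1}\rho^{\alpha}\le\mu(B(x,\rho))\le C\rho^{\alpha}$ for all $x\in\operatorname{supp}\mu$ and $0<\rho\le\rho_0$, where $B(x,\rho)=[x-\rho,x+\rho]$. Let $\varphi=(\varphi_1,\dots,\varphi_n):U\to\mathbb R^n$ be real analytic and nondegenerate, i.e. $1,\varphi_1,\dots,\varphi_n$ are linearly independent over $\mathbb R$ as functions on $U$, and let $x_0\in\operatorname{supp}\mu\cap U$. For an interval $I$ and $\lambda>0$, $|I|$ is the length of $I$ and $\lambda I$ is the interval of length $\lambda|I|$ with the same centre. For $\mathbf x\in\mathbb R^n$ let $u(\mathbf x)\in \mathrm{SL}_{n+1}(\mathbb R)$ be the identity matrix with its first row replaced by $(1,x_1,\dots,x_n)$. For $x\in U$ let $z(x)\in \mathrm{SL}_{n+1}(\mathbb R)$ be the identity matrix with its second row replaced by $(0,1,\varphi_2'(x),\dots,\varphi_n'(x))$. For $\tau\in\mathbb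 R^{n+1}$ with $\tau_1+\dots+\tau_{n+1}=0$ let $g_\tau=\operatorname{diag}(e^{\tau_1},\dots,e^{\tau_{n+1}})$. For $\delta>0$ let $K_\delta$ be the set of unimodular lattices $\Lambda\subset\mathbb R^{n+1}$ all of whose non-zero vectors have Euclidean norm at least $\delta$. **Theorem (Global Estimate).** There is $\ell_0>0$ such that the following holds for every closed interval $I_0$ centred at $x_0$ with $0<|I_0|\le \ell_0$, $3^{n+1}I_0\subset U$ and $\varphi_1(x)=x$ for all $x\in 3^{n+1}I_0$. There exist constants $M_2>0$ and $\gamma>0$ such that for every $\delta>0$ and every $\tau=(\tau_1,\dots,\tau_{n+1})\in\mathbb R^{n+1}$ with $\tau_1+\dots+\tau_{n+1}=0$, $\tau_1>0$ and $\tau_i<0$ for $i=3,\dots,n+1$, $$\mu\bigl(\{x\in I_0:\ g_\tau z(x)u(\varphi(x))\mathbb Z^{n+1}\notin K_\delta\}\bigr)\le M_2\,\delta^{\gamma}.$$ -/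

import Mathlib

open MeasureTheory
open scoped Matrix

noncomputable section

namespace FractalQnD

/-! Throughout, the dimension `n ≥ 1` of the ambient space of the curve is written `n = m + 1`,
so that `ℝⁿ` is indexed by `Fin (m + 1)` and `(n + 1) × (n + 1)` matrices by `Fin (m + 2)`. The
coordinates `1, …, n` (resp. `1, …, n + 1`) become `0, …, m` (resp. `0, …, m + 1`). -/

/-- `μ` is a `(C, α)`-Ahlfors regular measure on `ℝ`. -/
def IsAhlforsRegular (μ : Measure ℝ) (C α : ℝ) : Prop :=
  1 < C ∧ 0 < α ∧ ∃ ρ₀ : ℝ, 0 < ρ₀ ∧ ∀ x ∈ μ.support, ∀ ρ : ℝ, 0 < ρ → ρ ≤ ρ₀ →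
    ENNReal.ofReal (C⁻¹ * ρ ^ α) ≤ μ (Metric.closedBall x ρ) ∧
      μ (Metric.closedBall x ρ) ≤ ENNReal.ofReal (C * ρ ^ α)

/-- The functions `1, φ₁, …, φₙ` on `U` are linearly independent over `ℝ`. -/
def IsNondegenerate {n : ℕ} (U : Set ℝ) (φ : ℝ → Fin n → ℝ) : Prop :=
  LinearIndependent ℝ
    (fun (i : Fin (n + 1)) (x : U) => (Fin.cons 1 (φ x) : Fin (n + 1) → ℝ) i)

/-- The closed interval of length `l` centred at `x₀`. -/
def centredInterval (x₀ l : ℝ) : Set ℝ := Set.Icc (x₀ - l / 2) (x₀ + l / 2)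

/-- The lattice `g ℤᵏ` in Euclidean space `ℝᵏ`. -/
def lat {k : ℕ} (g : Matrix.SpecialLinearGroup (Fin k) ℝ) : Set (EuclideanSpace ℝ (Fin k)) :=
  Set.range fun w : Fin k → ℤ => WithLp.toLp 2 ((g : Matrix (Fin k) (Fin k) ℝ) *ᵥ fun i => (w i : ℝ))

/-- The space of unimodular lattices in `ℝᵏ`. -/
def unimodularLattices (k : ℕ) : Set (Set (EuclideanSpace ℝ (Fin k))) :=
  Set.range (lat (k := k))

/-- The set `K_ε` of unimodular lattices all of whose non-zero vectors have Euclidean norm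
at least `ε`. -/
def K (k : ℕ) (ε : ℝ) : Set (Set (EuclideanSpace ℝ (Fin k))) :=
  {Λ | Λ ∈ unimodularLattices k ∧ ∀ v ∈ Λ, v ≠ 0 → ε ≤ ‖v‖}

/-- Replacing row `i` of the identity matrix by a row whose `i`th entry is `1` gives
determinant `1`. -/
theorem det_updateRow_one {k : ℕ} (i : Fin k) (r : Fin k → ℝ) (hi : r i = 1) :
    ((1 : Matrix (Fin k) (Fin k) ℝ).updateRow i r).det = 1 := by
  have h : r = ∑ j, r j • (1 : Matrix (Fin k) (Fin k) ℝ) j := by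
    ext l
    simp [Finset.sum_apply, Matrix.one_apply]
  rw [h, Matrix.det_updateRow_sum]
  simp [hi]

/-- `u(x)`: the identity matrix with first row replaced by `(1, x₁, …, xₙ)`. -/
def u {n : ℕ} (x : Fin n → ℝ) : Matrix.SpecialLinearGroup (Fin (n + 1)) ℝ :=
  ⟨(1 : Matrix (Fin (n + 1)) (Fin (n + 1)) ℝ).updateRow 0 (Fin.cons 1 x),
    det_updateRow_one _ _ (by simp)⟩

/-- `u₁(y)`, `y = (y₂, …, yₙ)`: the identity matrix with second row replaced by
`(0, 1, y₂, …, yₙ)`. -/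
def u₁ {m : ℕ} (y : Fin m → ℝ) : Matrix.SpecialLinearGroup (Fin (m + 2)) ℝ :=
  ⟨(1 : Matrix (Fin (m + 2)) (Fin (m + 2)) ℝ).updateRow 1 (Fin.cons 0 (Fin.cons 1 y)),
    det_updateRow_one _ _ (by
      change (Fin.cons 0 (Fin.cons 1 y) : Fin (m + 2) → ℝ) (Fin.succ 0) = 1
      simp)⟩

/-- `ψ(x) = (φ₂'(x), …, φₙ'(x))`. -/
def ψ {m : ℕ} (φ : ℝ → Fin (m + 1) → ℝ) (x : ℝ) : Fin m → ℝ :=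
  fun j => deriv (fun t => φ t j.succ) x

/-- `z(x) = u₁(ψ(x))`. -/
def z {m : ℕ} (φ : ℝ → Fin (m + 1) → ℝ) (x : ℝ) : Matrix.SpecialLinearGroup (Fin (m + 2)) ℝ :=
  u₁ (ψ φ x)

/-- `g_τ = diag(e^{τ₁}, …, e^{τₖ})`, where `τ₁ + … + τₖ = 0`. -/
def g {k : ℕ} (τ : Fin k → ℝ) (hτ : ∑ i, τ i = 0) : Matrix.SpecialLinearGroup (Fin k) ℝ :=
  ⟨Matrix.diagonal fun i => Real.exp (τ i), by
    rw [Matrix.det_diagonal, ← Real.exp_sum, hτ, Real.exp_zero]⟩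

/-- `W(τ, J, δ) = {x ∈ J : g_τ z(x) u(φ(x)) ℤⁿ⁺¹ ∉ K_δ}`. -/
def W {m : ℕ} (φ : ℝ → Fin (m + 1) → ℝ) (τ : Fin (m + 2) → ℝ) (hτ : ∑ i, τ i = 0)
    (J : Set ℝ) (δ : ℝ) : Set ℝ :=
  {x | x ∈ J ∧ lat (g τ hτ * z φ x * u (φ x)) ∉ K (m + 2) δ}

end FractalQnD

end

open MeasureTheory
open scoped Matrix

noncomputable section

namespace FractalQnD

open Set Metric Filter Topology

/-! The proof is quantitative nondivergence in the manner of Kleinbock and Margulis, for an Ahlfors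
regular measure. Put A(x) = z(x)u(φ(x)) and N = n + 1. Short vectors of g_τ A(x)ℤᴺ are detected by
the covolumes p_V(x) of the images of rational subspaces V. Three facts are combined.

Goodness. Up to a scalar, the Plücker coordinates of g_τ A(x)V lie in one finite-dimensional span of
analytic functions, the same for all V and τ. Near x₀ an element of this span that is small at 2ᴸ
well-separated points is small throughout (`exists_sublevelSeparated_span`), so its sublevel sets
are covered by few small balls and their measure decays like a power with exponent α/L
(`measure_sublevel_le`).

Size. Some ρ > 0 is reached by every p_V on I₀, uniformly in V and τ. The first row of A is (1, φ)
and, since φ₁(x) = x, the second row is its derivative. Nondegeneracy gives a nonzero Wronskian, so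
for dim V ≥ 2 some nonzero minor uses both of these rows. Then g_τ does not contract that minor,
because only negative τᵢ are left out. For dim V = 1 the first row suffices, as τ₁ > 0. Compactness
of orthonormal frames and integrality of Gram determinants make ρ uniform
(`exists_uniform_plucker_lower_bound`).

Covering. Flags of rational subspaces are grown one member at a time by Vitali coverings
(`measure_unmarked_le`). Outside a set of measure O(ε^(α/L)), a point of the support carries a flag
with covolumes in [ε, ρ] whose compatible subspaces all have covolume at least ρ. At such a point no
nonzero lattice vector is shorter than ε/N (`norm_mulVec_ge_of_marked`); take ε = Nδ. -/

/-! ### Sublevel estimates for spans of analytic functions. -/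

/-- On every interval `[a, b] ⊆ J`, a bound for `|h|` at `2 ^ L` points with gaps at least `s`
bounds `|h|` on the whole interval, with a loss of a constant times `((b - a) / s) ^ L`. -/
def SublevelSeparated (J : Set ℝ) (L : ℕ) (A : ℝ) (h : ℝ → ℝ) : Prop :=
  ∀ a b : ℝ, Icc a b ⊆ J → ∀ s ε : ℝ, 0 < s → s ≤ b - a → 0 ≤ ε → ∀ x : ℕ → ℝ,
    (∀ i < 2 ^ L, x i ∈ Icc a b) → (∀ i, i + 1 < 2 ^ L → x i + s ≤ x (i + 1)) →
    (∀ i < 2 ^ L, |h (x i)| ≤ ε) → ∀ y ∈ Icc a b, |h y| * s ^ L ≤ A * ε * (b - a) ^ L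

theorem SublevelSeparated.mono {J J' : Set ℝ} {L L' : ℕ} {A A' : ℝ} {h : ℝ → ℝ}
    (H : SublevelSeparated J L A h) (hJ : J' ⊆ J) (hL : L ≤ L') (hA : A ≤ A') :
    SublevelSeparated J' L' A' h := by
  intro a b hab s ε hs hsb hε x hx hgap hval y hy
  have h2 : 2 ^ L ≤ 2 ^ L' := Nat.pow_le_pow_right (by norm_num) hL
  have h1 := H a b (hab.trans hJ) s ε hs hsb hε x (fun i hi => hx i (by omega))
    (fun i hi => hgap i (by omega)) (fun i hi => hval i (by omega)) y hy
  have hd : 0 < b - a := by linarith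
  have h3 : |h y| * s ^ L ≤ A' * ε * (b - a) ^ L :=
    h1.trans (by gcongr)
  have h0 : 0 ≤ A' * ε * (b - a) ^ L := le_trans (by positivity) h3
  have e1 : s ^ L' = s ^ L * s ^ (L' - L) := by rw [← pow_add]; congr 1; omega
  have e2 : (b - a) ^ L' = (b - a) ^ L * (b - a) ^ (L' - L) := by
    rw [← pow_add]; congr 1; omega
  rw [e1, e2, ← mul_assoc, ← mul_assoc]
  gcongr

theorem SublevelSeparated.const_mul {J : Set ℝ} {L : ℕ} {A : ℝ} {h : ℝ → ℝ}
    (H : SublevelSeparated J L A h) (hA : 0 ≤ A) (c : ℝ) :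
    SublevelSeparated J L A (fun x => c * h x) := by
  intro a b hab s ε hs hsb hε x hx hgap hval y hy
  rcases eq_or_ne c 0 with rfl | hc
  · have hd : 0 < b - a := by linarith
    simp only [zero_mul, abs_zero]
    positivity
  · have hc' : 0 < |c| := abs_pos.2 hc
    have := H a b hab s (ε / |c|) hs hsb (by positivity) x hx hgap
      (fun i hi => by rw [le_div_iff₀ hc']; simpa [abs_mul, mul_comm] using hval i hi) y hy
    rw [abs_mul]
    calc |c| * |h y| * s ^ L = |c| * (|h y| * s ^ L) := by ring
      _ ≤ |c| * (A * (ε / |c|) * (b - a) ^ L) := by gcongr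
      _ = _ := by field_simp

/-- The mean value theorem on consecutive pairs of points turns 2 ^ (L + 1) small values of `h` into
2 ^ L small values of its derivative; the inductive bound on the derivative is then integrated back.
The constant depends only on `κ`, `K` and `L`, which permits a compactness argument over `h`. -/
theorem sublevelSeparated_of_iteratedDeriv {J : Set ℝ} {κ K : ℝ}
    (hκ : 0 < κ) (hK : 0 ≤ K) (L : ℕ) :
    ∃ A : ℝ, 0 ≤ A ∧ ∀ h : ℝ → ℝ, AnalyticOnNhd ℝ h J →
      (∀ x ∈ J, κ ≤ |iteratedDeriv L h x| ∧ |iteratedDeriv L h x| ≤ K) →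
      SublevelSeparated J L A h := by
  induction L with
  | zero =>
    refine ⟨K / κ, by positivity, fun h _ hb a b hab s ε hs hsb hε x hx _ hval y hy => ?_⟩
    simp only [iteratedDeriv_zero] at hb
    have h1 := (hb _ (hab (hx 0 (by norm_num)))).1.trans (hval 0 (by norm_num))
    have h2 := (hb _ (hab hy)).2
    simp only [pow_zero, mul_one]
    calc |h y| ≤ K := h2
      _ = K / κ * κ := by field_simp
      _ ≤ K / κ * ε := by gcongr
  | succ L ih =>
    obtain ⟨A, hA, ih⟩ := ih
    refine ⟨1 + 2 * A, by positivity, fun h hh hb a b hab s ε hs hsb hε x hx hgap hval y hy => ?_⟩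
    have hd : 0 < b - a := by linarith
    have hdiff : ∀ t ∈ J, HasDerivAt h (deriv h t) t := fun t ht =>
      (hh t ht).differentiableAt.hasDerivAt
    have H := ih (deriv h) hh.deriv (fun t ht => by simpa only [iteratedDeriv_succ'] using hb t ht)
    have hpow : 2 ^ (L + 1) = 2 * 2 ^ L := by ring
    -- Disjoint pairs are used: the unused gap between `x (2 * i + 1)` and `x (2 * i + 2)` keeps the
    -- new points at distance at least `s`.
    have hex : ∀ i : ℕ, ∃ ξ : ℝ, i < 2 ^ L →
        ξ ∈ Ioo (x (2 * i)) (x (2 * i + 1)) ∧ |deriv h ξ| ≤ 2 * ε / s := by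
      intro i
      by_cases hi : i < 2 ^ L
      · have hg := hgap (2 * i) (by omega)
        have h1 := hx (2 * i) (by omega)
        have h2 := hx (2 * i + 1) (by omega)
        have hsub : Icc (x (2 * i)) (x (2 * i + 1)) ⊆ J :=
          (Icc_subset_Icc h1.1 h2.2).trans hab
        obtain ⟨ξ, hξ, hξ'⟩ := exists_hasDerivAt_eq_slope h (deriv h)
          (a := x (2 * i)) (b := x (2 * i + 1)) (by linarith)
          (fun t ht => (hdiff t (hsub ht)).continuousAt.continuousWithinAt)
          (fun t ht => hdiff t (hsub (Ioo_subset_Icc_self ht)))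
        refine ⟨ξ, fun _ => ⟨hξ, ?_⟩⟩
        have hpos : 0 < x (2 * i + 1) - x (2 * i) := by linarith
        rw [hξ', abs_div, abs_of_pos hpos]
        have h3 : |h (x (2 * i + 1)) - h (x (2 * i))| ≤ 2 * ε := by
          have := abs_sub (h (x (2 * i + 1))) (h (x (2 * i)))
          linarith [hval (2 * i) (by omega), hval (2 * i + 1) (by omega)]
        have h4 : s ≤ x (2 * i + 1) - x (2 * i) := by linarith
        gcongr
      · exact ⟨0, fun h => absurd h hi⟩
    choose ξ hξ using hex
    have hbound : ∀ t ∈ Icc a b, |deriv h t| * s ^ L ≤ A * (2 * ε / s) * (b - a) ^ L := by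
      refine H a b hab s (2 * ε / s) hs hsb (by positivity) ξ ?_ ?_ (fun i hi => (hξ i hi).2)
      · intro i hi
        have h1 := hx (2 * i) (by omega)
        have h2 := hx (2 * i + 1) (by omega)
        have h3 := (hξ i hi).1
        exact ⟨h1.1.trans h3.1.le, h3.2.le.trans h2.2⟩
      · intro i hi
        have h3 := (hξ i (by omega)).1.2
        have h4 := (hξ (i + 1) hi).1.1
        have h5 := hgap (2 * i + 1) (by omega)
        have e : 2 * (i + 1) = 2 * i + 1 + 1 := by ring
        rw [e] at h4
        linarith
    have hx0 := hx 0 (by positivity)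
    set B := A * (2 * ε / s) * (b - a) ^ L / s ^ L with hB
    have hB0 : 0 ≤ B := by positivity
    have hder : ∀ t ∈ Icc a b, ‖deriv h t‖ ≤ B := fun t ht => by
      rw [hB, le_div_iff₀ (by positivity), Real.norm_eq_abs]; exact hbound t ht
    have hmv := (convex_Icc a b).norm_image_sub_le_of_norm_hasDerivWithin_le
      (fun t ht => (hdiff t (hab ht)).hasDerivWithinAt) hder hx0 hy
    rw [Real.norm_eq_abs, Real.norm_eq_abs] at hmv
    have h6 : |y - x 0| ≤ b - a := abs_sub_le_iff.2 ⟨by linarith [hy.2, hx0.1], by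
      linarith [hy.1, hx0.2]⟩
    have h7 : |h y| ≤ ε + B * (b - a) := by
      have := abs_sub_abs_le_abs_sub (h y) (h (x 0))
      have h8 : B * |y - x 0| ≤ B * (b - a) := by gcongr
      linarith [hval 0 (by positivity)]
    calc |h y| * s ^ (L + 1) ≤ (ε + B * (b - a)) * s ^ (L + 1) := by gcongr
      _ = ε * s ^ (L + 1) + 2 * A * ε * (b - a) ^ (L + 1) := by
        rw [hB]; field_simp; ring
      _ ≤ ε * (b - a) ^ (L + 1) + 2 * A * ε * (b - a) ^ (L + 1) := by gcongr
      _ = _ := by ring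

/-- Greedy choice: take a point of `E` within `s` of its infimum, discard the ball of radius `s`
about it, and continue to the right. If this stops early, the discarded balls cover `E`. -/
theorem exists_gap_points_or_measure_le (μ : Measure ℝ) {s : ℝ} {M : ENNReal} (hs : 0 < s)
    (hM : ∀ y, μ (closedBall y s) ≤ M) (n : ℕ) : ∀ E : Set ℝ, BddBelow E →
      (∃ x : ℕ → ℝ, (∀ i < n, x i ∈ E) ∧ ∀ i, i + 1 < n → x i + s ≤ x (i + 1)) ∨
        μ E ≤ n * M := by
  induction n with
  | zero => exact fun E _ => Or.inl ⟨fun _ => 0, by simp, by simp⟩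
  | succ n ih =>
    intro E hE
    rcases E.eq_empty_or_nonempty with rfl | hne
    · right; simp
    obtain ⟨x₀, hx₀, hlt⟩ : ∃ x₀ ∈ E, x₀ < sInf E + s :=
      exists_lt_of_csInf_lt hne (by linarith)
    rcases ih (E ∩ Ici (x₀ + s)) (hE.mono inter_subset_left) with ⟨x, hx, hgap⟩ | hμ
    · left
      refine ⟨fun i => Nat.casesOn i x₀ x, ?_, ?_⟩
      · rintro (_ | i) hi
        · exact hx₀
        · exact (hx i (by omega)).1
      · rintro (_ | i) hi
        · exact (hx 0 (by omega)).2
        · exact hgap i (by omega)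
    · right
      have hsub : E ⊆ closedBall x₀ s ∪ (E ∩ Ici (x₀ + s)) := by
        intro y hy
        by_cases h : x₀ + s ≤ y
        · exact Or.inr ⟨hy, h⟩
        · left
          have := csInf_le hE hy
          rw [mem_closedBall, Real.dist_eq, abs_le]
          constructor <;> linarith
      calc μ E ≤ μ (closedBall x₀ s) + μ (E ∩ Ici (x₀ + s)) :=
            (measure_mono hsub).trans (measure_union_le _ _)
        _ ≤ M + n * M := add_le_add (hM _) hμ
        _ = _ := by push_cast; ring

/-- If the sublevel set contained 2 ^ L points with gaps `s`, the separated estimate would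
contradict the value at least `ρ` at `z`; hence 2 ^ L balls of radius `s` cover it. -/
theorem measure_sublevel_le {μ : Measure ℝ} {Cμ α t₁ : ℝ} (hC : 0 < Cμ) (hα : 0 < α)
    (hμ : ∀ y t, 0 < t → t ≤ t₁ → μ (closedBall y t) ≤ ENNReal.ofReal (Cμ * t ^ α))
    {J : Set ℝ} {L : ℕ} {A : ℝ} {h : ℝ → ℝ} (hL : 1 ≤ L) (hA : 0 < A)
    (H : SublevelSeparated J L A h) {y t ρ ε : ℝ} (ht : 0 < t) (ht₁ : 2 * t ≤ t₁)
    (hJ : closedBall y t ⊆ J) (hρ : 0 < ρ) (hε : 0 < ε) (hz : ∃ z ∈ closedBall y t, ρ ≤ |h z|) :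
    μ {x | x ∈ closedBall y t ∧ |h x| < ε} ≤
      ENNReal.ofReal (Cμ * 2 ^ L * 2 ^ α * (2 * A * ε / ρ) ^ (α / L) * t ^ α) := by
  obtain ⟨z, hz, hρz⟩ := hz
  set q := 2 * A * ε / ρ with hq
  have hq0 : 0 < q := by positivity
  have h2L : (1 : ℝ) ≤ 2 ^ L := one_le_pow₀ (by norm_num)
  have h2α : (1 : ℝ) ≤ 2 ^ α := Real.one_le_rpow (by norm_num) hα.le
  have htα : 0 < t ^ α := Real.rpow_pos_of_pos ht α
  have hL0 : (0 : ℝ) < L := by exact_mod_cast hL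
  rcases le_or_gt 1 q with h1 | h1
  · have hqα : 1 ≤ q ^ (α / L) := Real.one_le_rpow h1 (by positivity)
    refine (measure_mono (fun x hx => hx.1)).trans ((hμ y t ht (by linarith)).trans ?_)
    apply ENNReal.ofReal_le_ofReal
    have : 1 ≤ 2 ^ L * 2 ^ α * q ^ (α / L) :=
      one_le_mul_of_one_le_of_one_le (one_le_mul_of_one_le_of_one_le h2L h2α) hqα
    calc Cμ * t ^ α = Cμ * 1 * t ^ α := by ring
      _ ≤ Cμ * (2 ^ L * 2 ^ α * q ^ (α / L)) * t ^ α := by gcongr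
      _ = _ := by ring
  -- Chosen so that (s / 2t) ^ L = q. The factor 2 in `q` makes the separated estimate read 2Aε ≤
  -- Aε, up to a positive factor.
  · set s := 2 * t * q ^ (1 / (L : ℝ)) with hs
    have hs0 : 0 < s := by positivity
    have hs1 : s ≤ 2 * t := by
      have : q ^ (1 / (L : ℝ)) ≤ 1 := Real.rpow_le_one hq0.le h1.le (by positivity)
      calc s ≤ 2 * t * 1 := by rw [hs]; gcongr
        _ = _ := by ring
    have hsL : s ^ L = (2 * t) ^ L * q := by
      rw [hs, mul_pow, ← Real.rpow_natCast (q ^ _), ← Real.rpow_mul hq0.le,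
        one_div_mul_cancel hL0.ne', Real.rpow_one]
    have hsα : s ^ α = 2 ^ α * t ^ α * q ^ (α / L) := by
      rw [hs, Real.mul_rpow (by positivity) (by positivity), Real.mul_rpow (by norm_num) ht.le,
        ← Real.rpow_mul hq0.le, one_div_mul_eq_div]
    have hball := Real.closedBall_eq_Icc (x := y) (r := t)
    rcases exists_gap_points_or_measure_le μ hs0 (fun w => hμ w s hs0 (hs1.trans ht₁)) (2 ^ L)
      {x | x ∈ closedBall y t ∧ |h x| < ε}
      ⟨y - t, fun x hx => by rw [hball] at hx; exact hx.1.1⟩ with ⟨x, hx, hgap⟩ | hle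
    · exfalso
      rw [hball] at hJ hz
      have := H (y - t) (y + t) hJ s ε hs0 (by linarith) hε.le x
        (fun i hi => by rw [← hball]; exact (hx i hi).1) hgap (fun i hi => (hx i hi).2.le) z hz
      have e : y + t - (y - t) = 2 * t := by ring
      rw [e, hsL] at this
      have h3 : ρ * ((2 * t) ^ L * q) ≤ A * ε * (2 * t) ^ L :=
        le_trans (by gcongr) this
      have h4 : ρ * ((2 * t) ^ L * q) = 2 * (A * ε * (2 * t) ^ L) := by
        rw [hq]; field_simp
      have h5 : 0 < A * ε * (2 * t) ^ L := by positivity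
      linarith
    · refine hle.trans (le_of_eq ?_)
      rw [show ((2 ^ L : ℕ) : ENNReal) = ENNReal.ofReal (2 ^ L) by
        rw [ENNReal.ofReal_pow (by norm_num)]; simp, ← ENNReal.ofReal_mul (by positivity), hsα]
      congr 1
      ring

/-- Around a point where finitely many functions are analytic, their linear combinations satisfy
a uniform sublevel estimate. -/
theorem exists_sublevelSeparated_span {ι : Type*} [Fintype ι] {G : ι → ℝ → ℝ} {x₀ : ℝ}
    (hG : ∀ i, AnalyticAt ℝ (G i) x₀) :
    ∃ R > 0, ∃ L : ℕ, ∃ A : ℝ, 1 ≤ L ∧ 0 < A ∧ ∀ c : ι → ℝ,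
      SublevelSeparated (ball x₀ R) L A (fun x => ∑ i, c i * G i x) := by
  obtain ⟨R₀, hR₀, hGR⟩ : ∃ R₀ > 0, ∀ i, AnalyticOnNhd ℝ (G i) (ball x₀ R₀) := by
    have : ∀ᶠ x in 𝓝 x₀, ∀ i, AnalyticAt ℝ (G i) x :=
      eventually_all.2 fun i => (hG i).eventually_analyticAt
    obtain ⟨R₀, hR₀, h⟩ := Metric.eventually_nhds_iff_ball.1 this
    exact ⟨R₀, hR₀, fun i x hx => h x hx i⟩
  set hc : EuclideanSpace ℝ ι → ℝ → ℝ := fun c x => ∑ i, c i * G i x with hhc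
  have han : ∀ c, AnalyticOnNhd ℝ (hc c) (ball x₀ R₀) := fun c =>
    Finset.analyticOnNhd_fun_sum _ fun i _ => analyticOnNhd_const.mul (hGR i)
  have hder : ∀ (c) (j : ℕ), ∀ x ∈ ball x₀ R₀,
      iteratedDeriv j (hc c) x = ∑ i, c i * iteratedDeriv j (G i) x := by
    intro c j x hx
    have hs := iteratedDeriv_fun_sum (n := j) (x := x) (I := Finset.univ)
      (f := fun i t => c i * G i t) fun i _ => contDiffAt_const.mul (hGR i x hx).contDiffAt
    refine hs.trans ?_
    exact Finset.sum_congr rfl fun i _ => iteratedDeriv_const_mul_field _ _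
  -- The `G i` may be dependent. Discarding the relations `Z` leaves the unit sphere of the
  -- orthogonal complement, a compact set of coefficients none of which gives the zero function.
  let Z : Submodule ℝ (EuclideanSpace ℝ ι) :=
    { carrier := {c | ∀ x ∈ ball x₀ R₀, hc c x = 0}
      add_mem' := fun {a b} ha hb x hx => by
        have h1 := ha x hx
        have h2 := hb x hx
        simp only [hhc] at h1 h2 ⊢
        simp [add_mul, Finset.sum_add_distrib, h1, h2]
      zero_mem' := fun x _ => by simp [hhc]
      smul_mem' := fun r a ha x hx => by
        have h1 := ha x hx
        simp only [hhc] at h1 ⊢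
        simp [mul_assoc, ← Finset.mul_sum, h1] }
  have hcompact : IsCompact (sphere (0 : EuclideanSpace ℝ ι) 1 ∩ (Zᗮ : Set _)) :=
    (isCompact_sphere 0 1).inter_right Z.isClosed_orthogonal
  obtain ⟨R, hR, L, A, hL, hA, hsep⟩ : ∃ R > 0, ∃ L : ℕ, ∃ A : ℝ, 1 ≤ L ∧ 0 < A ∧
      ∀ c ∈ sphere (0 : EuclideanSpace ℝ ι) 1 ∩ (Zᗮ : Set _),
        SublevelSeparated (ball x₀ R) L A (hc c) := by
    refine hcompact.induction_on (p := fun S => ∃ R > 0, ∃ L : ℕ, ∃ A : ℝ, 1 ≤ L ∧ 0 < A ∧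
      ∀ c ∈ S, SublevelSeparated (ball x₀ R) L A (hc c)) ?_ ?_ ?_ ?_
    · exact ⟨1, one_pos, 1, 1, le_rfl, one_pos, by simp⟩
    · rintro S T hST ⟨R, hR, L, A, hL, hA, h⟩
      exact ⟨R, hR, L, A, hL, hA, fun c hc => h c (hST hc)⟩
    · rintro S T ⟨R, hR, L, A, hL, hA, h⟩ ⟨R', hR', L', A', hL', hA', h'⟩
      refine ⟨min R R', lt_min hR hR', max L L', max A A', hL.trans (le_max_left _ _),
        hA.trans_le (le_max_left _ _), ?_⟩
      rintro c (hc | hc)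
      · exact (h c hc).mono (ball_subset_ball (min_le_left _ _)) (le_max_left _ _)
          (le_max_left _ _)
      · exact (h' c hc).mono (ball_subset_ball (min_le_right _ _)) (le_max_right _ _)
          (le_max_right _ _)
    · rintro c ⟨hc1, hcZ⟩
      have hcZ' : c ∉ Z := fun h => by
        have h0 : c = 0 := by
          have := Submodule.inner_right_of_mem_orthogonal h hcZ
          simpa using this
        rw [h0] at hc1
        simp at hc1
      -- By the identity theorem. This derivative stays between `D / 2` and `2 * D` in absolute
      -- value for nearby coefficients and points, which gives local constants.
      obtain ⟨j, hj⟩ : ∃ j, iteratedDeriv j (hc c) x₀ ≠ 0 := by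
        by_contra! hall
        apply hcZ'
        have htop : analyticOrderAt (hc c) x₀ = ⊤ := by
          rw [ENat.eq_top_iff_forall_ge]
          intro n
          exact (natCast_le_analyticOrderAt_iff_iteratedDeriv_eq_zero
            (han c x₀ (mem_ball_self hR₀))).2 fun i _ => hall i
        exact (han c).eqOn_zero_of_preconnected_of_eventuallyEq_zero
          (convex_ball x₀ R₀).isPreconnected (mem_ball_self hR₀) (analyticOrderAt_eq_top.1 htop)
      have hanj : ∀ i, ContinuousAt (iteratedDeriv j (G i)) x₀ := fun i => by
        rw [iteratedDeriv_eq_iterate]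
        exact ((hGR i).iterated_deriv j x₀ (mem_ball_self hR₀)).continuousAt
      have hcont : ContinuousAt (fun p : EuclideanSpace ℝ ι × ℝ =>
          ∑ i, p.1 i * iteratedDeriv j (G i) p.2) (c, x₀) := by
        refine tendsto_finsetSum _ fun i _ => ContinuousAt.mul ?_ ?_
        · fun_prop
        · exact ContinuousAt.comp (f := Prod.snd) (x := (c, x₀))
            (hanj i) continuousAt_snd
      set D := |iteratedDeriv j (hc c) x₀| with hD
      have hDpos : 0 < D := abs_pos.2 hj
      rw [hder c j x₀ (mem_ball_self hR₀)] at hD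
      have hev : ∀ᶠ p : EuclideanSpace ℝ ι × ℝ in 𝓝 c ×ˢ 𝓝 x₀,
          |∑ i, p.1 i * iteratedDeriv j (G i) p.2| ∈ Ioo (D / 2) (2 * D) := by
        rw [← nhds_prod_eq]
        refine hcont.abs.eventually (Ioo_mem_nhds ?_ ?_)
        · simp only [← hD]; linarith
        · simp only [← hD]; linarith
      obtain ⟨pa, hpa, pb, hpb, hp⟩ := eventually_prod_iff.1 hev
      obtain ⟨R₁, hR₁, hpb⟩ := Metric.eventually_nhds_iff_ball.1 hpb
      obtain ⟨A, hA, hAsep⟩ := sublevelSeparated_of_iteratedDeriv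
        (J := ball x₀ (min R₀ R₁)) (κ := D / 2) (K := 2 * D) (by positivity) (by positivity) j
      refine ⟨{c' | pa c'}, mem_nhdsWithin_of_mem_nhds hpa, min R₀ R₁, lt_min hR₀ hR₁,
        max j 1, A + 1, le_max_right _ _, by positivity, fun c' hc' => ?_⟩
      refine (hAsep (hc c') ((han c').mono (ball_subset_ball (min_le_left _ _))) ?_).mono
        subset_rfl (le_max_left _ _) (by linarith)
      intro x hx
      rw [hder c' j x (ball_subset_ball (min_le_left _ _) hx)]
      have := hp hc' (hpb x (ball_subset_ball (min_le_right _ _) hx))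
      exact ⟨this.1.le, this.2.le⟩
  refine ⟨min R R₀, lt_min hR hR₀, L, A, hL, hA, fun c => ?_⟩
  set c' : EuclideanSpace ℝ ι := WithLp.toLp 2 c with hc'
  obtain ⟨z, hz, q, hq, hzq⟩ := Z.exists_add_mem_mem_orthogonal c'
  have heq : ∀ x ∈ ball x₀ R₀, ∑ i, c i * G i x = ‖q‖ * hc (‖q‖⁻¹ • q) x := by
    intro x hx
    have h1 : hc z x = 0 := hz x hx
    have h2 : ∑ i, c i * G i x = hc z x + hc q x := by
      simp only [hhc, ← Finset.sum_add_distrib, ← add_mul]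
      refine Finset.sum_congr rfl fun i _ => ?_
      have : c i = (z + q) i := by rw [← hzq]
      rw [this]; rfl
    rw [h2, h1, zero_add]
    rcases eq_or_ne q 0 with rfl | hq0
    · simp [hhc]
    · have : ‖q‖ ≠ 0 := norm_ne_zero_iff.2 hq0
      simp only [hhc, Finset.mul_sum]
      refine Finset.sum_congr rfl fun i _ => ?_
      simp only [PiLp.smul_apply, smul_eq_mul]
      field_simp
  have hS : SublevelSeparated (ball x₀ R) L A (fun x => ‖q‖ * hc (‖q‖⁻¹ • q) x) := by
    rcases eq_or_ne q 0 with rfl | hq0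
    · intro a b _ s ε hs hsb hε x _ _ _ y _
      have hd : 0 < b - a := by linarith
      simp only [norm_zero, zero_mul, abs_zero]
      positivity
    · refine (hsep _ ⟨?_, Submodule.smul_mem _ _ hq⟩).const_mul hA.le _
      simp [norm_smul, norm_ne_zero_iff.2 hq0]
  intro a b hab s ε hs hsb hε x hx hgap hval y hy
  have hsub : ball x₀ (min R R₀) ⊆ ball x₀ R₀ := ball_subset_ball (min_le_right _ _)
  simp only [heq y (hsub (hab hy))]
  exact hS a b (hab.trans (ball_subset_ball (min_le_left _ _))) s ε hs hsb hε x hx hgap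
    (fun i hi => by simpa only [heq (x i) (hsub (hab (hx i hi)))] using hval i hi) y hy

/-! ### The covering argument over flags in a partially ordered set. -/

/-- Around a point where some `p s`, `s ∈ T`, is smaller than `ρ`, there is a ball on which some
`p s` is smaller than `ρ` while on the concentric ball of twice the radius none is. -/
theorem exists_critical_radius {S : Type*} {T : Set S} {p : S → ℝ → ℝ} {ρ y r x : ℝ} (hr : 0 < r)
    (hT : ∀ s ∈ T, ∃ z ∈ closedBall y r, ρ ≤ p s z) (hx : x ∈ closedBall y r)
    (hcont : ∀ s ∈ T, ContinuousAt (p s) x) (hlt : ∃ s ∈ T, p s x < ρ) :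
    ∃ t, 0 < t ∧ t ≤ 2 * r ∧ (∃ s ∈ T, ∀ z ∈ closedBall x t, p s z < ρ) ∧
      ∀ s ∈ T, ∃ z ∈ closedBall x (2 * t), ρ ≤ p s z := by
  -- Any element of `Q` above half its supremum will do, since its double is either outside `Q` or
  -- larger than `2 * r`.
  set Q : Set ℝ := {t | 0 < t ∧ t ≤ 2 * r ∧ ∃ s ∈ T, ∀ z ∈ closedBall x t, p s z < ρ} with hQ
  have hbdd : BddAbove Q := ⟨2 * r, fun t ht => ht.2.1⟩
  obtain ⟨t₀, ht₀⟩ : Q.Nonempty := by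
    obtain ⟨s, hs, hsx⟩ := hlt
    obtain ⟨t, ht, h⟩ := Metric.nhds_basis_closedBall.eventually_iff.1
      ((hcont s hs).eventually (gt_mem_nhds hsx))
    exact ⟨min t (2 * r), lt_min ht (by positivity), min_le_right _ _, s, hs,
      fun z hz => h (closedBall_subset_closedBall (min_le_left _ _) hz)⟩
  have hpos : 0 < sSup Q := ht₀.1.trans_le (le_csSup hbdd ht₀)
  obtain ⟨t, ht, hlt⟩ := exists_lt_of_lt_csSup ⟨t₀, ht₀⟩ (half_lt_self hpos)
  refine ⟨t, ht.1, ht.2.1, ht.2.2, fun s hs => ?_⟩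
  by_cases h2 : 2 * t ≤ 2 * r
  · by_contra! hcon
    have : 2 * t ∈ Q := ⟨by linarith [ht.1], h2, s, hs, hcon⟩
    linarith [le_csSup hbdd this]
  -- Here `2 * t > 2 * r`, so the doubled ball about `x` contains `closedBall y r`.
  · obtain ⟨z, hz, hzρ⟩ := hT s hs
    refine ⟨z, ?_, hzρ⟩
    rw [mem_closedBall] at hz hx ⊢
    have := dist_triangle_right z x y
    linarith

/-- Ahlfors regularity replaces each `t x ^ α` by the measure of a ball; the balls are disjoint and
lie in the ball of radius `2 * r` about `y`. -/
theorem sum_rpow_radius_le {μ : Measure ℝ} {X : Set ℝ} {D α t₁ : ℝ} (hD : 0 < D)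
    (hlow : ∀ x ∈ X, ∀ t, 0 < t → t ≤ t₁ →
      ENNReal.ofReal (t ^ α) ≤ ENNReal.ofReal D * μ (closedBall x t))
    (hup : ∀ y t, 0 < t → t ≤ t₁ → μ (closedBall y t) ≤ ENNReal.ofReal (D * t ^ α))
    {y r : ℝ} (hr : 0 < r) (hr₁ : 2 * r ≤ t₁) {u : Set ℝ} {t : ℝ → ℝ} (hcount : u.Countable)
    (hu : ∀ x ∈ u, x ∈ X ∧ x ∈ closedBall y r ∧ 0 < t x ∧ t x ≤ r)
    (hdisj : u.PairwiseDisjoint fun x => closedBall x (t x)) :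
    ∑' x : u, ENNReal.ofReal (t x ^ α) ≤ ENNReal.ofReal (D * D * 2 ^ α * r ^ α) := by
  have := hcount.to_subtype
  calc ∑' x : u, ENNReal.ofReal (t x ^ α)
      ≤ ∑' x : u, ENNReal.ofReal D * μ (closedBall x (t x)) :=
        ENNReal.tsum_le_tsum fun x => by
          obtain ⟨h1, _, h3, h4⟩ := hu x x.2
          exact hlow x h1 _ h3 (by linarith)
    _ = ENNReal.ofReal D * ∑' x : u, μ (closedBall x (t x)) := ENNReal.tsum_mul_left
    _ = ENNReal.ofReal D * μ (⋃ x ∈ u, closedBall x (t x)) := by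
        rw [measure_biUnion hcount hdisj fun x _ => measurableSet_closedBall]
    _ ≤ ENNReal.ofReal D * μ (closedBall y (2 * r)) := by
        gcongr
        refine iUnion₂_subset fun x hx => closedBall_subset_closedBall' ?_
        obtain ⟨_, h2, _, h4⟩ := hu x hx
        rw [mem_closedBall] at h2
        linarith
    _ ≤ ENNReal.ofReal D * ENNReal.ofReal (D * (2 * r) ^ α) := by
        gcongr
        exact hup y _ (by linarith) hr₁
    _ = _ := by
        rw [← ENNReal.ofReal_mul hD.le, Real.mul_rpow (by norm_num) hr.le]
        congr 1
        ring

section Marked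

variable {S : Type*} [PartialOrder S]

/-- The elements outside the flag `F` that are comparable with all of `F`. -/
def compatible (F : Finset S) : Set S := {s | s ∉ F ∧ ∀ f ∈ F, s ≤ f ∨ f ≤ s}

/-- The point `x` is `(ε, ρ)`-marked: there is a flag on which the functions `ψ s` take values in
`[ε, ρ]` at `x`, while they are at least `ρ` at `x` on all elements compatible with it. -/
def IsMarked (p : S → ℝ → ℝ) (ε ρ x : ℝ) : Prop :=
  ∃ F : Finset S, IsChain (· ≤ ·) (F : Set S) ∧ (∀ s ∈ F, ε ≤ p s x ∧ p s x ≤ ρ) ∧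
    ∀ s ∈ compatible F, ρ ≤ p s x

/-- The constants in the measure estimate for unmarked points. -/
def unmarkedConst (D α : ℝ) : ℕ → ℝ
  | 0 => 0
  | j + 1 => (1 + unmarkedConst D α j) * 10 ^ α * D * D * 2 ^ α

theorem unmarkedConst_nonneg {D α : ℝ} (hD : 0 < D) (j : ℕ) : 0 ≤ unmarkedConst D α j := by
  induction j with
  | zero => simp [unmarkedConst]
  | succ j ih => simp only [unmarkedConst]; positivity

theorem compatible_insert_subset [DecidableEq S] (F : Finset S) (s : S) :
    compatible (insert s F) ⊆ compatible F := fun _ ht =>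
  ⟨fun h => ht.1 (Finset.mem_insert_of_mem h), fun f hf => ht.2 f (Finset.mem_insert_of_mem hf)⟩

/-- Induction on `j`, which bounds how many members the flag can still gain. For `j = 0` nothing is
compatible with the flag, so every point considered is marked. Otherwise an unmarked point has a
compatible `s` with value below `ρ`; on a ball of critical radius, either `p s < ε`, which `hgood`
makes rare, or `s` joins the flag and induction applies. -/
theorem measure_unmarked_le {μ : Measure ℝ} {X J : Set ℝ} {D α t₁ ε ρ η : ℝ} {N : ℕ}
    {p : S → ℝ → ℝ} (hD : 0 < D) (hη : 0 ≤ η)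
    (hlow : ∀ x ∈ X, ∀ t, 0 < t → t ≤ t₁ →
      ENNReal.ofReal (t ^ α) ≤ ENNReal.ofReal D * μ (closedBall x t))
    (hup : ∀ y t, 0 < t → t ≤ t₁ → μ (closedBall y t) ≤ ENNReal.ofReal (D * t ^ α))
    (hchain : ∀ F : Finset S, IsChain (· ≤ ·) (F : Set S) → F.card ≤ N)
    (hcont : ∀ s, ∀ x ∈ J, ContinuousAt (p s) x)
    (hgood : ∀ s y t, 0 < t → 2 * t ≤ t₁ → closedBall y t ⊆ J →
      (∃ z ∈ closedBall y t, ρ ≤ p s z) →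
        μ {x | x ∈ closedBall y t ∧ p s x < ε} ≤ ENNReal.ofReal (η * t ^ α))
    (j : ℕ) : ∀ F : Finset S, IsChain (· ≤ ·) (F : Set S) → N ≤ F.card + j → ∀ y r : ℝ, 0 < r →
      2 * (5 ^ j * r) ≤ t₁ → closedBall y (5 ^ j * r) ⊆ J →
      (∀ s ∈ compatible F, ∃ z ∈ closedBall y r, ρ ≤ p s z) →
      μ {x | (x ∈ closedBall y r ∧ x ∈ X) ∧ (∀ s ∈ F, ε ≤ p s x ∧ p s x ≤ ρ) ∧
        ¬ IsMarked p ε ρ x} ≤ ENNReal.ofReal (unmarkedConst D α j * η * r ^ α) := by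
  classical
  have hins : ∀ (F : Finset S), IsChain (· ≤ ·) (F : Set S) → ∀ s ∈ compatible F,
      IsChain (· ≤ ·) ((insert s F : Finset S) : Set S) := fun F hF s hs => by
    rw [Finset.coe_insert]
    exact hF.insert fun b hb _ => hs.2 b hb
  induction j with
  | zero =>
    intro F hF hN y r _ _ _ _
    refine le_of_eq_of_le ?_ zero_le
    convert measure_empty (μ := μ)
    rw [eq_empty_iff_forall_notMem]
    rintro x ⟨_, hFx, hx⟩
    refine hx ⟨F, hF, hFx, fun s hs => ?_⟩
    have := hchain _ (hins F hF s hs)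
    rw [Finset.card_insert_of_notMem hs.1] at this
    omega
  | succ j ih =>
    intro F hF hN y r hr hr₁ hJ hT
    set E : Set ℝ := {x | (x ∈ closedBall y r ∧ x ∈ X) ∧ (∀ s ∈ F, ε ≤ p s x ∧ p s x ≤ ρ) ∧
        ¬ IsMarked p ε ρ x} with hE
    have h5 : (1 : ℝ) ≤ 5 ^ j := one_le_pow₀ (by norm_num)
    have h5r : r ≤ 5 ^ j * r := le_mul_of_one_le_left hr.le h5
    have h5s : (5 : ℝ) ^ (j + 1) * r = 5 * (5 ^ j * r) := by ring
    rcases E.eq_empty_or_nonempty with hE0 | ⟨x', hx'⟩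
    · rw [hE0, measure_empty]
      exact zero_le
    have hex : ∀ x ∈ E, ∃ t s, 0 < t ∧ t ≤ 2 * r ∧ s ∈ compatible F ∧
        (∀ z ∈ closedBall x t, p s z < ρ) ∧
        ∀ s' ∈ compatible F, ∃ z ∈ closedBall x (2 * t), ρ ≤ p s' z := by
      intro x hx
      have hxJ : x ∈ J := hJ (closedBall_subset_closedBall (by linarith) hx.1.1)
      obtain ⟨t, h1, h2, ⟨s, hs, h3⟩, h4⟩ := exists_critical_radius hr hT hx.1.1
        (fun s _ => hcont s x hxJ) (by
          by_contra! hcon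
          exact hx.2.2 ⟨F, hF, hx.2.1, hcon⟩)
      exact ⟨t, s, h1, h2, hs, h3, h4⟩
    have : Nonempty S := ⟨(hex x' hx').choose_spec.choose⟩
    choose! t s hts using hex
    -- Radii are divided by 5 so that the selected balls are disjoint while those of full critical
    -- radius cover `E`.
    obtain ⟨u, huE, hdisj, hcov⟩ := Vitali.exists_disjoint_subfamily_covering_enlargement_closedBall
      E (fun x => x) (fun x => t x / 5) r
      (fun x hx => by linarith [(hts x hx).2.1]) 5 (by norm_num)
    have hcount : u.Countable := hdisj.countable_of_nonempty_interior fun x hx => by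
      rw [interior_closedBall _ (by linarith [(hts x (huE hx)).1])]
      exact ⟨x, mem_ball_self (by linarith [(hts x (huE hx)).1])⟩
    have hsub : E ⊆ ⋃ x ∈ u, ({z | z ∈ closedBall x (2 * t x) ∧ p (s x) z < ε} ∪
        {z | (z ∈ closedBall x (2 * t x) ∧ z ∈ X) ∧
          (∀ s' ∈ insert (s x) F, ε ≤ p s' z ∧ p s' z ≤ ρ) ∧ ¬ IsMarked p ε ρ z}) := by
      intro z hz
      obtain ⟨x, hx, hzx⟩ := hcov z hz
      have h0 := (hts x (huE hx)).1
      have hz1 : z ∈ closedBall x (t x) := by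
        have := hzx (mem_closedBall_self (by linarith [(hts z hz).1]))
        rwa [mul_div_cancel₀ _ (by norm_num : (5 : ℝ) ≠ 0)] at this
      have hz2 : z ∈ closedBall x (2 * t x) := closedBall_subset_closedBall (by linarith) hz1
      refine mem_biUnion hx ?_
      by_cases hε : p (s x) z < ε
      · exact Or.inl ⟨hz2, hε⟩
      · refine Or.inr ⟨⟨hz2, hz.1.2⟩, fun s' hs' => ?_, hz.2.2⟩
        rcases Finset.mem_insert.1 hs' with rfl | h
        · exact ⟨not_lt.1 hε, ((hts x (huE hx)).2.2.2.1 z hz1).le⟩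
        · exact hz.2.1 s' h
    set B := unmarkedConst D α j with hB
    have hB0 : 0 ≤ B := unmarkedConst_nonneg hD j
    calc μ E ≤ ∑' x : u, μ ({z | z ∈ closedBall x.1 (2 * t x) ∧ p (s x) z < ε} ∪
        {z | (z ∈ closedBall x.1 (2 * t x) ∧ z ∈ X) ∧
          (∀ s' ∈ insert (s x) F, ε ≤ p s' z ∧ p s' z ≤ ρ) ∧ ¬ IsMarked p ε ρ z}) :=
          (measure_mono hsub).trans (measure_biUnion_le μ hcount _)
      _ ≤ ∑' x : u, ENNReal.ofReal ((1 + B) * η * 10 ^ α) * ENNReal.ofReal ((t x / 5) ^ α) := by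
          refine ENNReal.tsum_le_tsum fun x => (measure_union_le _ _).trans ?_
          obtain ⟨h1, h2, h3, h4, h6⟩ := hts x (huE x.2)
          have hxy : dist x.1 y ≤ r := (huE x.2).1.1
          -- Since `t x ≤ 2 * r`, the reach from `y` is at most 4 · 5ʲ r + r ≤ 5ʲ⁺¹ r; this is why
          -- the hypotheses involve powers of 5.
          have hb : closedBall x.1 (5 ^ j * (2 * t x)) ⊆ J := by
            refine (closedBall_subset_closedBall' ?_).trans hJ
            have : (5 : ℝ) ^ j * (2 * t x) ≤ 5 ^ j * (2 * (2 * r)) := by gcongr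
            rw [h5s]
            linarith
          have h7 : (5 : ℝ) ^ j * (2 * t x) ≤ 5 ^ j * (2 * (2 * r)) := by gcongr
          have h8 : 2 * t x ≤ 5 ^ j * (2 * t x) := le_mul_of_one_le_left (by linarith) h5
          have e1 : (2 * t x) ^ α = 10 ^ α * (t x / 5) ^ α := by
            rw [← Real.mul_rpow (by norm_num) (by positivity)]
            congr 1
            ring
          have g1 := hgood (s x) x (2 * t x) (by linarith) (by linarith)
            ((closedBall_subset_closedBall h8).trans hb) (h6 _ h3)
          have g2 := ih (insert (s x) F) (hins F hF _ h3)
            (by rw [Finset.card_insert_of_notMem h3.1]; omega) x (2 * t x) (by linarith)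
            (by linarith) hb (fun s' hs' => h6 s' (compatible_insert_subset F _ hs'))
          refine (add_le_add g1 g2).trans (le_of_eq ?_)
          rw [← ENNReal.ofReal_add (by positivity) (by positivity),
            ← ENNReal.ofReal_mul (by positivity), e1]
          congr 1
          ring
      _ = ENNReal.ofReal ((1 + B) * η * 10 ^ α) * ∑' x : u, ENNReal.ofReal ((t x / 5) ^ α) :=
          ENNReal.tsum_mul_left
      _ ≤ ENNReal.ofReal ((1 + B) * η * 10 ^ α) * ENNReal.ofReal (D * D * 2 ^ α * r ^ α) := by
          refine mul_le_mul' le_rfl ?_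
          refine sum_rpow_radius_le (y := y) (t := fun x => t x / 5) hD hlow hup hr (by linarith) hcount
            (fun x hx => ?_) hdisj
          obtain ⟨h1, h2, -⟩ := hts x (huE hx)
          exact ⟨(huE hx).1.2, (huE hx).1.1, by positivity, by linarith⟩
      _ = _ := by
          rw [← ENNReal.ofReal_mul (by positivity), unmarkedConst]
          congr 1
          ring

end Marked

/-! ### Plücker coordinates, rational subspaces and their covolumes. -/

/-- The Plücker coordinates of a `k`-tuple of vectors. -/
def plucker {k N : ℕ} (w : Fin k → Fin N → ℝ) : (Fin k → Fin N) → ℝ :=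
  fun σ => (Matrix.of fun i j => w j (σ i)).det

theorem plucker_comb {k N : ℕ} {w w' : Fin k → Fin N → ℝ} (c : Matrix (Fin k) (Fin k) ℝ)
    (h : ∀ j, w' j = ∑ i, c i j • w i) : plucker w' = c.det • plucker w := by
  ext σ
  simp only [plucker, Pi.smul_apply, smul_eq_mul]
  rw [mul_comm, ← Matrix.det_mul]
  congr 1
  ext i j
  simp [Matrix.mul_apply, h, mul_comm]

theorem norm_plucker_cons_le {k N : ℕ} (v : Fin N → ℝ) (w : Fin k → Fin N → ℝ) :
    ‖plucker (Fin.cons v w : Fin (k + 1) → Fin N → ℝ)‖ ≤ (k + 1) * ‖v‖ * ‖plucker w‖ := by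
  refine (pi_norm_le_iff_of_nonneg (by positivity)).2 fun σ => ?_
  have e : plucker (Fin.cons v w : Fin (k + 1) → Fin N → ℝ) σ =
      ∑ i : Fin (k + 1), (-1) ^ (i : ℕ) * v (σ i) * plucker w (fun j => σ (i.succAbove j)) := by
    simp only [plucker]
    rw [Matrix.det_succ_column_zero]
    rfl
  rw [e]
  refine (norm_sum_le _ _).trans ?_
  calc ∑ i : Fin (k + 1), ‖(-1) ^ (i : ℕ) * v (σ i) * plucker w (fun j => σ (i.succAbove j))‖
      ≤ ∑ _i : Fin (k + 1), ‖v‖ * ‖plucker w‖ := by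
        refine Finset.sum_le_sum fun i _ => ?_
        rw [norm_mul, norm_mul, norm_pow, norm_neg, norm_one, one_pow, one_mul]
        exact mul_le_mul (norm_le_pi_norm _ _) (norm_le_pi_norm _ _) (norm_nonneg _)
          (norm_nonneg _)
    _ = _ := by
        simp only [Finset.sum_const, Finset.card_univ, Fintype.card_fin, nsmul_eq_mul]
        push_cast
        ring

theorem norm_plucker_zero {N : ℕ} (w : Fin 0 → Fin N → ℝ) : ‖plucker w‖ ≤ 1 :=
  (pi_norm_le_iff_of_nonneg zero_le_one).2 fun σ => by simp [plucker]

theorem plucker_diagonal {k N : ℕ} (d : Fin N → ℝ) (w : Fin k → Fin N → ℝ) (σ : Fin k → Fin N) :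
    plucker (fun j => Matrix.diagonal d *ᵥ w j) σ = (∏ i, d (σ i)) * plucker w σ := by
  simp only [plucker, Matrix.mulVec_diagonal]
  exact Matrix.det_mul_column (fun i => d (σ i)) (Matrix.of fun i j => w j (σ i))

/-- Multilinear expansion of the rows. The coefficients are monomials in the entries of `B`,
independent of `w`; this later confines all Plücker coordinates to one finite-dimensional span. -/
theorem plucker_mulVec {k N : ℕ} (B : Matrix (Fin N) (Fin N) ℝ) (w : Fin k → Fin N → ℝ)
    (σ : Fin k → Fin N) :
    plucker (fun j => B *ᵥ w j) σ = ∑ q : Fin k → Fin N, plucker w q * ∏ i, B (σ i) (q i) := by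
  have e : (Matrix.of fun i j => (B *ᵥ w j) (σ i)) =
      fun i : Fin k => ∑ l : Fin N, B (σ i) l • (fun j => w j l) := by
    ext i j
    simp [Matrix.mulVec, dotProduct]
  simp only [plucker]
  rw [e]
  have h := (Matrix.detRowAlternating (n := Fin k) (R := ℝ)).toMultilinearMap.map_sum
    (fun (i : Fin k) (l : Fin N) => B (σ i) l • (fun j => w j l))
  refine h.trans (Finset.sum_congr rfl fun q _ => ?_)
  have h2 := (Matrix.detRowAlternating (n := Fin k) (R := ℝ)).toMultilinearMap.map_smul_univ
    (fun i => B (σ i) (q i)) (fun i j => w j (q i))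
  refine h2.trans ?_
  rw [smul_eq_mul, mul_comm]
  rfl

/-- A tuple of integer vectors, viewed as a tuple of real vectors. -/
def toReal {k N : ℕ} (w : Fin k → Fin N → ℤ) : Fin k → Fin N → ℝ := fun j i => (w j i : ℝ)

/-- The Gram determinant of a tuple of integer vectors. -/
def gramDet {k N : ℕ} (w : Fin k → Fin N → ℤ) : ℤ := (Matrix.of w * (Matrix.of w)ᵀ).det

theorem cast_gramDet {k N : ℕ} (w : Fin k → Fin N → ℤ) :
    (gramDet w : ℝ) = (Matrix.of (toReal w) * (Matrix.of (toReal w))ᵀ).det := by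
  have := RingHom.map_det (Int.castRingHom ℝ) (Matrix.of w * (Matrix.of w)ᵀ)
  simp only [eq_intCast] at this
  rw [gramDet, this]
  congr 1
  ext i j
  simp [Matrix.mul_apply, toReal]

theorem gramDet_ne_zero {k N : ℕ} {w : Fin k → Fin N → ℤ}
    (h : LinearIndependent ℝ (toReal w)) : gramDet w ≠ 0 := by
  intro h0
  have h1 : (Matrix.of (toReal w) * (Matrix.of (toReal w))ᵀ).det = 0 := by
    rw [← cast_gramDet, h0, Int.cast_zero]
  obtain ⟨v, hv, hv0⟩ := Matrix.exists_vecMul_eq_zero_iff.2 h1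
  refine hv ((Matrix.vecMul_injective_iff (M := Matrix.of (toReal w))).2 h ?_)
  simp only [Matrix.zero_vecMul]
  apply dotProduct_self_eq_zero.1
  rw [← Matrix.vecMul_vecMul, Matrix.vecMul_transpose] at hv0
  rw [← Matrix.dotProduct_mulVec, hv0, dotProduct_zero]

theorem gramDet_comb {k N : ℕ} {w w' : Fin k → Fin N → ℤ} (c : Matrix (Fin k) (Fin k) ℝ)
    (h : ∀ j, toReal w' j = ∑ i, c i j • toReal w i) :
    (gramDet w' : ℝ) = c.det ^ 2 * gramDet w := by
  have e : Matrix.of (toReal w') = cᵀ * Matrix.of (toReal w) := by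
    ext i j
    simp [h, Matrix.mul_apply]
  rw [cast_gramDet, cast_gramDet, e, Matrix.transpose_mul, Matrix.transpose_transpose,
    Matrix.mul_assoc, ← Matrix.mul_assoc _ _ c, Matrix.det_mul, Matrix.det_mul, Matrix.det_transpose]
  ring

/-- The subspace is spanned by linearly independent integer vectors. -/
def IsIntSpan {N : ℕ} (V : Submodule ℝ (Fin N → ℝ)) : Prop :=
  ∃ (k : ℕ) (w : Fin k → Fin N → ℤ), LinearIndependent ℝ (toReal w) ∧
    Submodule.span ℝ (range (toReal w)) = V

theorem exists_comb_of_span_le {k N : ℕ} {w w' : Fin k → Fin N → ℝ}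
    (h : Submodule.span ℝ (range w') ≤ Submodule.span ℝ (range w)) :
    ∃ c : Matrix (Fin k) (Fin k) ℝ, ∀ j, w' j = ∑ i, c i j • w i := by
  have : ∀ j, ∃ c : Fin k → ℝ, ∑ i, c i • w i = w' j := fun j =>
    (Submodule.mem_span_range_iff_exists_fun ℝ).1 (h (Submodule.subset_span ⟨j, rfl⟩))
  choose c hc using this
  exact ⟨fun i j => c j i, fun j => (hc j).symm⟩

/-- The absolute Gram determinant is a natural number, so it has a minimiser among integer bases of
`V`. Passing to any other integer basis multiplies Plücker coordinates by a determinant of absolute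
value at least 1, hence one basis is minimal for all `B` at once. -/
theorem IsIntSpan.exists_minimal {N : ℕ} {V : Submodule ℝ (Fin N → ℝ)} (hV : IsIntSpan V) :
    ∃ (k : ℕ) (w : Fin k → Fin N → ℤ), (LinearIndependent ℝ (toReal w) ∧
      Submodule.span ℝ (range (toReal w)) = V) ∧
      ∀ (k' : ℕ) (w' : Fin k' → Fin N → ℤ), LinearIndependent ℝ (toReal w') →
        Submodule.span ℝ (range (toReal w')) = V → ∀ B : Matrix (Fin N) (Fin N) ℝ,
          ‖plucker fun j => B *ᵥ toReal w j‖ ≤ ‖plucker fun j => B *ᵥ toReal w' j‖ := by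
  obtain ⟨k, w₀, hw₀⟩ := hV
  obtain ⟨w, hw, hmin⟩ := (measure fun w : Fin k → Fin N → ℤ => (gramDet w).natAbs).wf.has_min
    {w | LinearIndependent ℝ (toReal w) ∧ Submodule.span ℝ (range (toReal w)) = V} ⟨w₀, hw₀⟩
  refine ⟨k, w, hw, fun k' w' hw' hV' B => ?_⟩
  obtain rfl : k' = k := by
    have h1 := finrank_span_eq_card hw.1
    have h2 := finrank_span_eq_card hw'
    rw [hw.2] at h1
    rw [hV', h1] at h2
    simpa using h2.symm
  obtain ⟨c, hc⟩ := exists_comb_of_span_le (hV'.trans hw.2.symm).le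
  have hg := gramDet_comb c hc
  have hle : (gramDet w).natAbs ≤ (gramDet w').natAbs := not_lt.1 (hmin w' ⟨hw', hV'⟩)
  have hle' : |(gramDet w : ℝ)| ≤ |(gramDet w' : ℝ)| := by
    rw [← Int.cast_abs, ← Int.cast_abs, Int.abs_eq_natAbs, Int.abs_eq_natAbs]
    exact_mod_cast hle
  have hpos : 0 < |(gramDet w : ℝ)| := abs_pos.2 (by exact_mod_cast gramDet_ne_zero hw.1)
  rw [hg, abs_mul, abs_of_nonneg (sq_nonneg c.det), ← sq_abs] at hle'
  have hc1 : 1 ≤ |c.det| := by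
    by_contra! hlt
    have : |c.det| ^ 2 < 1 := pow_lt_one₀ (abs_nonneg _) hlt two_ne_zero
    nlinarith
  have hB : ∀ j, B *ᵥ toReal w' j = ∑ i, c i j • B *ᵥ toReal w i := fun j => by
    rw [hc j, Matrix.mulVec_sum]
    simp only [Matrix.mulVec_smul]
  rw [plucker_comb (w := fun j => B *ᵥ toReal w j) c hB, norm_smul, Real.norm_eq_abs]
  exact le_mul_of_one_le_left (norm_nonneg _) hc1

/-- The nonzero rational subspaces of `ℝᴺ`. -/
abbrev RatSubspace (N : ℕ) : Type :=
  {V : Submodule ℝ (Fin N → ℝ) // V ≠ ⊥ ∧ IsIntSpan V}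

/-- The dimension of a rational subspace. -/
def RatSubspace.dim {N : ℕ} (V : RatSubspace N) : ℕ := V.2.2.exists_minimal.choose

/-- An integer basis of a rational subspace with the smallest possible covolume. -/
def RatSubspace.basis {N : ℕ} (V : RatSubspace N) : Fin V.dim → Fin N → ℤ :=
  V.2.2.exists_minimal.choose_spec.choose

theorem RatSubspace.basis_spec {N : ℕ} (V : RatSubspace N) :
    (LinearIndependent ℝ (toReal V.basis) ∧
      Submodule.span ℝ (range (toReal V.basis)) = V.1) ∧
      ∀ (k' : ℕ) (w' : Fin k' → Fin N → ℤ), LinearIndependent ℝ (toReal w') →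
        Submodule.span ℝ (range (toReal w')) = V.1 → ∀ B : Matrix (Fin N) (Fin N) ℝ,
          ‖plucker fun j => B *ᵥ toReal V.basis j‖ ≤ ‖plucker fun j => B *ᵥ toReal w' j‖ :=
  V.2.2.exists_minimal.choose_spec.choose_spec

/-- The covolume, in the sup norm of Plücker coordinates, of the image under `B` of the lattice of
integer points of `V`. -/
def RatSubspace.covol {N : ℕ} (B : Matrix (Fin N) (Fin N) ℝ) (V : RatSubspace N) : ℝ :=
  ‖plucker fun j => B *ᵥ toReal V.basis j‖

theorem RatSubspace.dim_pos {N : ℕ} (V : RatSubspace N) : 0 < V.dim := by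
  by_contra! h
  have h0 : IsEmpty (Fin V.dim) := ⟨fun i => absurd i.pos (by omega)⟩
  apply V.2.1
  rw [← V.basis_spec.1.2, range_eq_empty, Submodule.span_empty]

theorem RatSubspace.card_le_of_isChain {N : ℕ} (F : Finset (RatSubspace N))
    (hF : IsChain (· ≤ ·) (F : Set (RatSubspace N))) : F.card ≤ N := by
  have h : F.card ≤ (Finset.Icc 1 N).card := by
    refine Finset.card_le_card_of_injOn (fun V => Module.finrank ℝ V.1) (fun V _ => ?_) ?_
    · simp only [Finset.coe_Icc, mem_Icc]
      refine ⟨Submodule.one_le_finrank_iff.2 V.2.1, ?_⟩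
      simpa using Submodule.finrank_le V.1
    · intro V hV W hW hVW
      rcases hF.total hV hW with h | h
      · exact Subtype.ext (Submodule.eq_of_le_of_finrank_eq h hVW)
      · exact Subtype.ext (Submodule.eq_of_le_of_finrank_eq h hVW.symm).symm
  simpa using h

/-- Adjoin `v` to the largest flag member not containing it. The resulting space lies in the flag or
is compatible with it, so its covolume is at least `ε`; by Laplace expansion that covolume is at
most `N` times the norm of `B *ᵥ v` times a covolume at most `ρ ≤ 1`. -/
theorem norm_mulVec_ge_of_marked {N : ℕ} {B : Matrix (Fin N) (Fin N) ℝ} {ε ρ : ℝ} (hερ : ε ≤ ρ)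
    (hρ : ρ ≤ 1) {F : Finset (RatSubspace N)}
    (hF : IsChain (· ≤ ·) (F : Set (RatSubspace N)))
    (hFB : ∀ V ∈ F, ε ≤ V.covol B ∧ V.covol B ≤ ρ) (hc : ∀ V ∈ compatible F, ρ ≤ V.covol B)
    {v : Fin N → ℤ} (hv : v ≠ 0) : ε ≤ N * ‖B *ᵥ fun i => (v i : ℝ)‖ := by
  classical
  set v' : Fin N → ℝ := fun i => (v i : ℝ) with hv'
  have hv0 : v' ≠ 0 := fun h => hv (by
    ext i
    have := congrFun h i
    simpa [hv'] using this)
  -- If every flag member contains `v`, the empty tuple is used; its Plücker norm is at most 1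
  -- because the empty determinant is 1.
  obtain ⟨k, w, hw, hvw, hpl, hcmp⟩ : ∃ (k : ℕ) (w : Fin k → Fin N → ℤ),
      LinearIndependent ℝ (toReal w) ∧ v' ∉ Submodule.span ℝ (range (toReal w)) ∧
      ‖plucker fun j => B *ᵥ toReal w j‖ ≤ 1 ∧ ∀ V ∈ F,
        V.1 ≤ Submodule.span ℝ (range (toReal w)) ∨
        (Submodule.span ℝ (range (toReal w)) ≤ V.1 ∧ v' ∈ V.1) := by
    rcases (F.filter fun V => v' ∉ V.1).eq_empty_or_nonempty with h0 | hne
    · refine ⟨0, Fin.elim0, linearIndependent_empty_type, ?_, norm_plucker_zero _, ?_⟩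
      · rw [range_eq_empty, Submodule.span_empty]
        simpa using hv0
      · intro V hV
        right
        rw [range_eq_empty, Submodule.span_empty]
        refine ⟨bot_le, ?_⟩
        by_contra hcon
        have : V ∈ F.filter fun V => v' ∉ V.1 := Finset.mem_filter.2 ⟨hV, hcon⟩
        rw [h0] at this
        simp at this
    · obtain ⟨V₀, hV₀, hmax⟩ := Finset.exists_maximal hne
      rw [Finset.mem_filter] at hV₀
      refine ⟨V₀.dim, V₀.basis, V₀.basis_spec.1.1, ?_, (hFB V₀ hV₀.1).2.trans hρ, ?_⟩
      · rw [V₀.basis_spec.1.2]; exact hV₀.2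
      · intro V hV
        rw [V₀.basis_spec.1.2]
        rcases hF.total hV hV₀.1 with h | h
        · exact Or.inl h
        · by_cases hvV : v' ∈ V.1
          · exact Or.inr ⟨h, hvV⟩
          · exact Or.inl (hmax (Finset.mem_filter.2 ⟨hV, hvV⟩) h)
  have hcons : toReal (Fin.cons v w : Fin (k + 1) → Fin N → ℤ) = Fin.cons v' (toReal w) := by
    ext j
    refine Fin.cases ?_ (fun j => ?_) j <;> simp [toReal, hv']
  have hli : LinearIndependent ℝ (toReal (Fin.cons v w : Fin (k + 1) → Fin N → ℤ)) := by
    rw [hcons]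
    exact linearIndependent_finCons.2 ⟨hw, hvw⟩
  have hspan : Submodule.span ℝ (range (toReal (Fin.cons v w : Fin (k + 1) → Fin N → ℤ))) =
      Submodule.span ℝ {v'} ⊔ Submodule.span ℝ (range (toReal w)) := by
    rw [hcons, Fin.range_cons, Submodule.span_insert]
  have hvmem : v' ∈ Submodule.span ℝ (range (toReal (Fin.cons v w : Fin (k + 1) → Fin N → ℤ))) := by
    rw [hspan]
    exact Submodule.mem_sup_left (Submodule.mem_span_singleton_self v')
  let V : RatSubspace N := ⟨_, fun h => hv0 (by rw [h] at hvmem; simpa using hvmem),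
    k + 1, _, hli, rfl⟩
  have hVε : ε ≤ V.covol B := by
    by_cases hVF : V ∈ F
    · exact (hFB V hVF).1
    · refine hερ.trans (hc V ⟨hVF, fun W hW => ?_⟩)
      change V.1 ≤ W.1 ∨ W.1 ≤ V.1
      change _ ≤ _ ∨ _ ≤ Submodule.span ℝ _
      rw [hspan]
      rcases hcmp W hW with h | h
      · exact Or.inr (h.trans le_sup_right)
      · refine Or.inl ?_
        change Submodule.span ℝ _ ≤ _
        rw [hspan]
        exact sup_le (by simpa using h.2) h.1
  have hle := V.basis_spec.2 _ _ hli rfl B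
  have e : (fun j => B *ᵥ toReal (Fin.cons v w : Fin (k + 1) → Fin N → ℤ) j) =
      (Fin.cons (B *ᵥ v') fun j => B *ᵥ toReal w j : Fin (k + 1) → Fin N → ℝ) := by
    rw [hcons]
    funext j
    refine Fin.cases ?_ (fun j => ?_) j <;> simp
  rw [e] at hle
  have hk : ((k : ℝ) + 1) ≤ N := by
    have := hli.fintype_card_le_finrank
    simp only [Fintype.card_fin, Module.finrank_fintype_fun_eq_card] at this
    exact_mod_cast this
  calc ε ≤ V.covol B := hVε
    _ ≤ _ := hle
    _ ≤ (k + 1) * ‖B *ᵥ v'‖ * ‖plucker fun j => B *ᵥ toReal w j‖ := norm_plucker_cons_le _ _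
    _ ≤ N * ‖B *ᵥ v'‖ * 1 := by gcongr
    _ = _ := mul_one _

/-! ### Uniform lower bounds for the noncontracted Plücker coordinates. -/

theorem eqOn_zero_of_open_subset {U O : Set ℝ} (hU : IsPreconnected U) (hO : IsOpen O)
    (hOU : O ⊆ U) (hne : O.Nonempty) {f : ℝ → ℝ} (hf : AnalyticOnNhd ℝ f U)
    (h : ∀ x ∈ O, f x = 0) : ∀ x ∈ U, f x = 0 := by
  obtain ⟨x, hx⟩ := hne
  exact hf.eqOn_zero_of_preconnected_of_eventuallyEq_zero hU (hOU hx)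
    (eventually_of_mem (hO.mem_nhds hx) h)

/-- The Wronskian of two linearly independent analytic functions does not vanish identically. -/
theorem exists_wronskian_ne_zero {U O : Set ℝ} (hU : IsPreconnected U) (hO : IsOpen O)
    (hOU : O ⊆ U) (hne : O.Nonempty) {f₁ f₂ d₁ d₂ : ℝ → ℝ} (hf₁ : AnalyticOnNhd ℝ f₁ U)
    (hf₂ : AnalyticOnNhd ℝ f₂ U) (hd₁ : ∀ x ∈ O, HasDerivAt f₁ (d₁ x) x)
    (hd₂ : ∀ x ∈ O, HasDerivAt f₂ (d₂ x) x)
    (hind : ∀ a b : ℝ, (∀ x ∈ U, a * f₁ x + b * f₂ x = 0) → a = 0 ∧ b = 0) :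
    ∃ x ∈ O, f₁ x * d₂ x - f₂ x * d₁ x ≠ 0 := by
  by_contra! hW
  obtain ⟨x₁, hx₁, hf⟩ : ∃ x ∈ O, f₁ x ≠ 0 := by
    by_contra! h0
    have := eqOn_zero_of_open_subset hU hO hOU hne hf₁ h0
    have := (hind 1 0 fun x hx => by simp [this x hx]).1
    norm_num at this
  obtain ⟨r, hr, hball⟩ := Metric.eventually_nhds_iff_ball.1
    (((hd₁ x₁ hx₁).continuousAt.eventually_ne hf).and (hO.mem_nhds hx₁))
  have hder : ∀ x ∈ ball x₁ r, HasDerivAt (fun t => f₂ t / f₁ t) 0 x := fun x hx => by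
    obtain ⟨h0, hxO⟩ := hball x hx
    convert! (hd₂ x hxO).div (hd₁ x hxO) h0 using 1
    rw [eq_comm, div_eq_zero_iff]
    left
    linarith [hW x hxO]
  obtain ⟨c, hc⟩ := isOpen_ball.exists_is_const_of_deriv_eq_zero (convex_ball x₁ r).isPreconnected
    (fun x hx => (hder x hx).differentiableAt.differentiableWithinAt)
    (fun x hx => (hder x hx).deriv)
  have hzero : ∀ x ∈ U, -c * f₁ x + 1 * f₂ x = 0 := by
    refine eqOn_zero_of_open_subset hU isOpen_ball (fun x hx => hOU (hball x hx).2)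
      ⟨x₁, mem_ball_self hr⟩ ((analyticOnNhd_const.mul hf₁).add (analyticOnNhd_const.mul hf₂)) ?_
    intro x hx
    have h1 := hc x hx
    rw [div_eq_iff (hball x hx).1] at h1
    simp [h1]
  have := (hind _ _ hzero).2
  norm_num at this

/-- Linearly independent rows of a tuple of linearly independent vectors are part of a nonzero
maximal minor. -/
theorem exists_plucker_ne_zero {k N : ℕ} {w : Fin k → Fin N → ℝ} (hw : LinearIndependent ℝ w)
    {s : Set (Fin N)} (hs : LinearIndepOn ℝ (fun i j => w j i) s) :
    ∃ σ : Fin k → Fin N, Function.Injective σ ∧ s ⊆ range σ ∧ plucker w σ ≠ 0 := by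
  set r : Fin N → Fin k → ℝ := fun i j => w j i with hr
  set t := hs.extend (subset_univ s) with ht
  have hli : LinearIndepOn ℝ r t := hs.linearIndepOn_extend _
  have hspan : Module.finrank ℝ (Submodule.span ℝ (range r)) = k := by
    have h1 : (Matrix.of w).rank = k := by
      have := LinearIndependent.rank_matrix (M := Matrix.of w) hw
      simpa using this
    have h2 := Matrix.rank_eq_finrank_span_row (Matrix.of w)ᵀ
    rw [Matrix.rank_transpose, h1] at h2
    exact h2.symm
  have : Fintype t := Fintype.ofFinite t
  have hcard : Fintype.card t = k := by
    have h1 := finrank_span_eq_card (b := fun i : t => r i) hli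
    refine h1.symm.trans (Eq.trans ?_ hspan)
    rw [← image_univ (f := r), ← hs.span_image_extend_eq_span_image (subset_univ s), image_eq_range]
  let e : Fin k ≃ t := (Fintype.equivFinOfCardEq hcard).symm
  refine ⟨fun i => e i, Subtype.val_injective.comp e.injective, fun i hi => ?_, ?_⟩
  · exact ⟨e.symm ⟨i, hs.subset_extend _ hi⟩, by simp⟩
  · have h3 : LinearIndependent ℝ (Matrix.of fun i j => w j (e i)).row := hli.comp e e.injective
    have h4 := Matrix.linearIndependent_rows_iff_isUnit.1 h3
    exact ((Matrix.isUnit_iff_isUnit_det _).1 h4).ne_zero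

/-- The index sets whose weight is nonnegative for all the admissible exponents `τ`. -/
def IsExpanding {k m : ℕ} (σ : Fin k → Fin (m + 2)) : Prop :=
  ∀ τ : Fin (m + 2) → ℝ, ∑ i, τ i = 0 → 0 < τ 0 → (∀ i : Fin (m + 2), 2 ≤ (i : ℕ) → τ i < 0) →
    0 ≤ ∑ i, τ (σ i)

/-- As the `τ i` sum to zero, the weight is minus the sum over the omitted indices, all of which are
at least 2 and carry negative `τ i`. -/
theorem isExpanding_of_mem_range {k m : ℕ} {σ : Fin k → Fin (m + 2)} (hσ : Function.Injective σ)
    (h0 : 0 ∈ range σ) (h1 : 1 ∈ range σ) : IsExpanding σ := by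
  intro τ hτ _ hneg
  have e : ∑ i, τ (σ i) = ∑ i ∈ Finset.univ.map ⟨σ, hσ⟩, τ i := by simp
  have h2 : ∑ i ∈ (Finset.univ.map ⟨σ, hσ⟩)ᶜ, τ i ≤ 0 := by
    refine Finset.sum_nonpos fun i hi => (hneg i ?_).le
    by_contra! hlt
    have hi' : i ∉ range σ := by simpa using hi
    have : i = 0 ∨ i = 1 := by
      rw [Fin.ext_iff, Fin.ext_iff]
      simp only [Fin.val_zero, Fin.val_one]
      omega
    rcases this with rfl | rfl
    exacts [hi' h0, hi' h1]
  have h3 := Finset.sum_add_sum_compl (Finset.univ.map ⟨σ, hσ⟩) τ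
  rw [e]
  linarith

section LowerBound

variable {m : ℕ} {A : ℝ → Matrix (Fin (m + 2)) (Fin (m + 2)) ℝ} {U O : Set ℝ}

/-- The sign of `τ 1` is free, so for `k ≥ 2` a minor should contain both rows 0 and 1. Row 1 is the
derivative of row 0, so their independence at some `x` is the nonvanishing of the Wronskian of two
entries of row 0. For `k = 1`, row 0 alone works. -/
theorem exists_expanding_plucker_ne_zero (hU : IsPreconnected U) (hO : IsOpen O) (hOU : O ⊆ U)
    (hne : O.Nonempty) (hdet : ∀ x, (A x).det = 1)
    (hrow : ∀ q, AnalyticOnNhd ℝ (fun t => (A t *ᵥ q) 0) U)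
    (hder : ∀ x ∈ O, ∀ q, HasDerivAt (fun t => (A t *ᵥ q) 0) ((A x *ᵥ q) 1) x)
    (hind : ∀ q, (∀ x ∈ U, (A x *ᵥ q) 0 = 0) → q = 0) {k : ℕ} (hk : 0 < k)
    {q : Fin k → Fin (m + 2) → ℝ} (hq : LinearIndependent ℝ q) :
    ∃ x ∈ O, ∃ σ : Fin k → Fin (m + 2), IsExpanding σ ∧ plucker (fun j => A x *ᵥ q j) σ ≠ 0 := by
  have hA : ∀ x, LinearIndependent ℝ fun j => A x *ᵥ q j := fun x => by
    have hinj : Function.Injective (A x).mulVecLin := by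
      have : IsUnit (A x) := (Matrix.isUnit_iff_isUnit_det _).2 (by simp [hdet])
      exact Matrix.mulVec_injective_of_isUnit this
    exact hq.map' (A x).mulVecLin (LinearMap.ker_eq_bot.2 hinj)
  rcases Nat.lt_or_ge 1 k with h1 | h1
  · have hne01 : (⟨0, hk⟩ : Fin k) ≠ ⟨1, h1⟩ := by simp
    obtain ⟨x, hx, hW⟩ := exists_wronskian_ne_zero hU hO hOU hne
      (d₁ := fun x => (A x *ᵥ q ⟨0, hk⟩) 1) (d₂ := fun x => (A x *ᵥ q ⟨1, h1⟩) 1)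
      (hrow (q ⟨0, hk⟩)) (hrow (q ⟨1, h1⟩))
      (fun x hx => hder x hx _) (fun x hx => hder x hx _) (fun a b hab => by
        have hz := hind (a • q ⟨0, hk⟩ + b • q ⟨1, h1⟩) fun x hx => by
          rw [Matrix.mulVec_add, Matrix.mulVec_smul, Matrix.mulVec_smul]
          exact hab x hx
        exact (LinearIndepOn.pair_iff q hne01).1
          (hq.linearIndepOn _) a b hz)
    have hs : LinearIndepOn ℝ (fun i j => (A x *ᵥ q j) i) {(0 : Fin (m + 2)), 1} := by
      rw [LinearIndepOn.pair_iff _ (by simp)]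
      intro c d hcd
      have e0 := congrFun hcd ⟨0, hk⟩
      have e1 := congrFun hcd ⟨1, h1⟩
      simp only [Pi.add_apply, Pi.smul_apply, smul_eq_mul, Pi.zero_apply] at e0 e1
      constructor
      · refine (mul_eq_zero.1 (?_ : c * _ = 0)).resolve_right hW
        linear_combination (A x *ᵥ q ⟨1, h1⟩) 1 * e0 - (A x *ᵥ q ⟨0, hk⟩) 1 * e1
      · refine (mul_eq_zero.1 (?_ : d * _ = 0)).resolve_right hW
        linear_combination (A x *ᵥ q ⟨0, hk⟩) 0 * e1 - (A x *ᵥ q ⟨1, h1⟩) 0 * e0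
    obtain ⟨σ, hσ, hsub, hpl⟩ := exists_plucker_ne_zero (hA x) hs
    exact ⟨x, hx, σ, isExpanding_of_mem_range hσ (hsub (by simp)) (hsub (by simp)), hpl⟩
  · obtain rfl : k = 1 := by omega
    obtain ⟨x, hx, h0⟩ : ∃ x ∈ O, (A x *ᵥ q 0) 0 ≠ 0 := by
      by_contra! hcon
      exact hq.ne_zero 0 (hind _ (eqOn_zero_of_open_subset hU hO hOU hne (hrow _) hcon))
    refine ⟨x, hx, fun _ => 0, fun τ _ h _ => by simpa using h.le, ?_⟩
    simpa [plucker] using h0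

/-- The orthonormal `k`-tuples of vectors. -/
def orthonormalFrames (k N : ℕ) : Set (Fin k → Fin N → ℝ) :=
  {q | Matrix.of q * (Matrix.of q)ᵀ = 1}

theorem isCompact_orthonormalFrames (k N : ℕ) : IsCompact (orthonormalFrames k N) := by
  refine (isCompact_closedBall (0 : Fin k → Fin N → ℝ) 1).of_isClosed_subset ?_ ?_
  · refine isClosed_eq ?_ continuous_const
    exact Continuous.matrix_mul continuous_id (Continuous.matrix_transpose continuous_id)
  · intro q hq
    rw [mem_closedBall_zero_iff]
    refine (pi_norm_le_iff_of_nonneg zero_le_one).2 fun i =>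
      (pi_norm_le_iff_of_nonneg zero_le_one).2 fun l => ?_
    have h1 := congrFun (congrFun hq i) i
    simp only [Matrix.mul_apply, Matrix.of_apply, Matrix.transpose_apply, Matrix.one_apply_eq] at h1
    have h2 : q i l * q i l ≤ 1 := h1 ▸ Finset.single_le_sum
      (f := fun l => q i l * q i l) (fun l _ => mul_self_nonneg _) (Finset.mem_univ l)
    rw [Real.norm_eq_abs]
    exact abs_le_one_iff_mul_self_le_one.2 h2

theorem linearIndependent_of_mem_orthonormalFrames {k N : ℕ} {q : Fin k → Fin N → ℝ}
    (hq : q ∈ orthonormalFrames k N) : LinearIndependent ℝ q := by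
  refine (Matrix.vecMul_injective_iff (M := Matrix.of q)).1 fun v v' h => ?_
  have := congrArg (fun u => u ᵥ* (Matrix.of q)ᵀ) h
  simp only [Matrix.vecMul_vecMul] at this
  rw [show Matrix.of q * (Matrix.of q)ᵀ = 1 from hq] at this
  simpa using this

theorem exists_orthonormalFrame {k N : ℕ} {w : Fin k → Fin N → ℝ}
    (hw : LinearIndependent ℝ w) : ∃ q ∈ orthonormalFrames k N,
      ∃ c : Matrix (Fin k) (Fin k) ℝ, ∀ j, w j = ∑ i, c i j • q i := by
  let L : (Fin N → ℝ) ≃ₗ[ℝ] EuclideanSpace ℝ (Fin N) := (WithLp.linearEquiv 2 ℝ _).symm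
  have hLw : LinearIndependent ℝ (fun j => L (w j)) :=
    hw.map' L.toLinearMap (LinearMap.ker_eq_bot.2 L.injective)
  set b := InnerProductSpace.gramSchmidtNormed ℝ (fun j => L (w j)) with hb
  have hbo := InnerProductSpace.gramSchmidtNormed_orthonormal hLw
  have hsp : Submodule.span ℝ (range b) = Submodule.span ℝ (range fun j => L (w j)) := by
    rw [hb, InnerProductSpace.span_gramSchmidtNormed_range, InnerProductSpace.span_gramSchmidt]
  refine ⟨fun i => L.symm (b i), ?_, ?_⟩
  · rw [orthonormal_iff_ite] at hbo
    change _ * _ = _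
    ext i j
    rw [Matrix.one_apply, ← hbo i j, Matrix.mul_apply, PiLp.inner_apply]
    refine Finset.sum_congr rfl fun l _ => ?_
    simp [L, b, mul_comm]
  · refine exists_comb_of_span_le (Submodule.span_le.2 ?_)
    rintro _ ⟨j, rfl⟩
    have h1 : L (w j) ∈ Submodule.span ℝ (range b) := by
      rw [hsp]; exact Submodule.subset_span ⟨j, rfl⟩
    have h2 := Submodule.mem_map_of_mem (f := L.symm.toLinearMap) h1
    rw [Submodule.map_span, ← range_comp] at h2
    simpa [Function.comp_def] using h2

/-- On orthonormal frames the bound follows by compactness. An integer tuple is an orthonormal frame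
times `c`, where `c.det ^ 2` is a nonzero integer Gram determinant, so its Plücker coordinates are
at least as large as those of the frame. -/
theorem exists_uniform_plucker_lower_bound (hU : IsPreconnected U) (hO : IsOpen O) (hOU : O ⊆ U)
    (hne : O.Nonempty) (hdet : ∀ x, (A x).det = 1)
    (hrow : ∀ q, AnalyticOnNhd ℝ (fun t => (A t *ᵥ q) 0) U)
    (hder : ∀ x ∈ O, ∀ q, HasDerivAt (fun t => (A t *ᵥ q) 0) ((A x *ᵥ q) 1) x)
    (hind : ∀ q, (∀ x ∈ U, (A x *ᵥ q) 0 = 0) → q = 0) {k : ℕ} (hk : 0 < k) :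
    ∃ ρ > 0, ∀ w : Fin k → Fin (m + 2) → ℤ, LinearIndependent ℝ (toReal w) → ∃ x ∈ O,
      ∃ σ : Fin k → Fin (m + 2), IsExpanding σ ∧ ρ ≤ |plucker (fun j => A x *ᵥ toReal w j) σ| := by
  obtain ⟨ρ, hρ, H⟩ : ∃ ρ > 0, ∀ q ∈ orthonormalFrames k (m + 2), ∃ x ∈ O,
      ∃ σ : Fin k → Fin (m + 2), IsExpanding σ ∧ ρ ≤ |plucker (fun j => A x *ᵥ q j) σ| := by
    refine (isCompact_orthonormalFrames k (m + 2)).induction_on (p := fun S => ∃ ρ > 0, ∀ q ∈ S,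
      ∃ x ∈ O, ∃ σ : Fin k → Fin (m + 2), IsExpanding σ ∧
        ρ ≤ |plucker (fun j => A x *ᵥ q j) σ|) ⟨1, one_pos, by simp⟩ ?_ ?_ ?_
    · rintro S T hST ⟨ρ, hρ, h⟩
      exact ⟨ρ, hρ, fun q hq => h q (hST hq)⟩
    · rintro S T ⟨ρ, hρ, h⟩ ⟨ρ', hρ', h'⟩
      refine ⟨min ρ ρ', lt_min hρ hρ', ?_⟩
      rintro q (hq | hq)
      · obtain ⟨x, hx, σ, hσ, hle⟩ := h q hq
        exact ⟨x, hx, σ, hσ, (min_le_left _ _).trans hle⟩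
      · obtain ⟨x, hx, σ, hσ, hle⟩ := h' q hq
        exact ⟨x, hx, σ, hσ, (min_le_right _ _).trans hle⟩
    · intro q hq
      obtain ⟨x, hx, σ, hσ, hpl⟩ := exists_expanding_plucker_ne_zero hU hO hOU hne hdet hrow hder
        hind hk (linearIndependent_of_mem_orthonormalFrames hq)
      have hcont : Continuous fun q : Fin k → Fin (m + 2) → ℝ =>
          |plucker (fun j => A x *ᵥ q j) σ| := by
        refine Continuous.abs (Continuous.matrix_det ?_)
        refine continuous_matrix fun i j => ?_
        simp only [Matrix.of_apply, Matrix.mulVec, dotProduct]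
        fun_prop
      have hpos := abs_pos.2 hpl
      exact ⟨_, mem_nhdsWithin_of_mem_nhds (hcont.continuousAt.eventually
        (lt_mem_nhds (half_lt_self hpos))), _, half_pos hpos,
        fun q' hq' => ⟨x, hx, σ, hσ, le_of_lt hq'⟩⟩
  refine ⟨ρ, hρ, fun w hw => ?_⟩
  obtain ⟨q, hq, c, hc⟩ := exists_orthonormalFrame hw
  obtain ⟨x, hx, σ, hσ, hle⟩ := H q hq
  refine ⟨x, hx, σ, hσ, ?_⟩
  have hB : ∀ j, A x *ᵥ toReal w j = ∑ i, c i j • A x *ᵥ q i := fun j => by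
    rw [hc j, Matrix.mulVec_sum]
    simp only [Matrix.mulVec_smul]
  rw [plucker_comb (w := fun j => A x *ᵥ q j) c hB, Pi.smul_apply, smul_eq_mul, abs_mul]
  have hg : (gramDet w : ℝ) = c.det ^ 2 := by
    have e : Matrix.of (toReal w) = cᵀ * Matrix.of q := by
      ext i j
      simp [hc, Matrix.mul_apply]
    rw [cast_gramDet, e, Matrix.transpose_mul, Matrix.transpose_transpose, Matrix.mul_assoc,
      ← Matrix.mul_assoc _ _ c, show Matrix.of q * (Matrix.of q)ᵀ = 1 from hq, Matrix.one_mul,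
      Matrix.det_mul, Matrix.det_transpose, sq]
  have hc1 : 1 ≤ |c.det| := by
    have h1 : 1 ≤ |gramDet w| := Int.one_le_abs (gramDet_ne_zero hw)
    have h2 : (1 : ℝ) ≤ |(gramDet w : ℝ)| := by exact_mod_cast h1
    rw [hg, abs_pow] at h2
    exact (one_le_sq_iff₀ (abs_nonneg _)).1 h2
  exact hle.trans (le_mul_of_one_le_left (abs_nonneg _) hc1)

end LowerBound

/-! ### The nondivergence estimate for an analytic family of matrices. -/

theorem RatSubspace.dim_le {N : ℕ} (V : RatSubspace N) : V.dim ≤ N := by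
  simpa using V.basis_spec.1.1.fintype_card_le_finrank

/-- The diagonal matrix only rescales each coordinate, and the rest is a combination of the finitely
many monomials `G`; hence constants independent of `V` and `d`. -/
theorem exists_sublevelSeparated_plucker {N : ℕ} {A : ℝ → Matrix (Fin N) (Fin N) ℝ} {x₀ : ℝ}
    (hA : ∀ i j, AnalyticAt ℝ (fun x => A x i j) x₀) :
    ∃ R > 0, ∃ L : ℕ, ∃ B : ℝ, 1 ≤ L ∧ 0 < B ∧ ∀ (V : RatSubspace N) (d : Fin N → ℝ)
      (σ : Fin V.dim → Fin N), SublevelSeparated (ball x₀ R) L B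
        (fun x => plucker (fun j => (Matrix.diagonal d * A x) *ᵥ toReal V.basis j) σ) := by
  let G : (Σ k : Fin (N + 1), (Fin k → Fin N) × (Fin k → Fin N)) → ℝ → ℝ :=
    fun a x => ∏ i, A x (a.2.1 i) (a.2.2 i)
  obtain ⟨R, hR, L, B, hL, hB, H⟩ := exists_sublevelSeparated_span (G := G) (x₀ := x₀)
    fun a => Finset.analyticAt_fun_prod _ fun i _ => hA _ _
  refine ⟨R, hR, L, B, hL, hB, fun V d σ => ?_⟩
  have hmem : (fun x => plucker (fun j => (Matrix.diagonal d * A x) *ᵥ toReal V.basis j) σ) ∈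
      Submodule.span ℝ (range G) := by
    have e : (fun x => plucker (fun j => (Matrix.diagonal d * A x) *ᵥ toReal V.basis j) σ) =
        (∏ i, d (σ i)) • ∑ q : Fin V.dim → Fin N, plucker (toReal V.basis) q •
          G ⟨⟨V.dim, Nat.lt_succ_of_le V.dim_le⟩, σ, q⟩ := by
      funext x
      simp only [← Matrix.mulVec_mulVec, plucker_diagonal, plucker_mulVec, Pi.smul_apply,
        Finset.sum_apply, smul_eq_mul, G]
    rw [e]
    exact Submodule.smul_mem _ _ (Submodule.sum_mem _ fun q _ =>
      Submodule.smul_mem _ _ (Submodule.subset_span ⟨_, rfl⟩))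
  obtain ⟨c, hc⟩ := (Submodule.mem_span_range_iff_exists_fun ℝ).1 hmem
  rw [← hc]
  have e2 : (∑ i, c i • G i) = fun x => ∑ i, c i * G i x := by
    funext x
    simp [Finset.sum_apply]
  rw [e2]
  exact H c

theorem RatSubspace.measure_covol_lt_le {μ : Measure ℝ} {D α t₁ : ℝ} (hD : 0 < D) (hα : 0 < α)
    (hup : ∀ y t, 0 < t → t ≤ t₁ → μ (closedBall y t) ≤ ENNReal.ofReal (D * t ^ α))
    {N : ℕ} {J : Set ℝ} {L : ℕ} {B : ℝ} (hL : 1 ≤ L) (hB : 0 < B)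
    {A : ℝ → Matrix (Fin N) (Fin N) ℝ} (V : RatSubspace N)
    (hV : ∀ σ : Fin V.dim → Fin N,
      SublevelSeparated J L B (fun x => plucker (fun j => A x *ᵥ toReal V.basis j) σ))
    {y t ρ ε : ℝ} (ht : 0 < t) (ht₁ : 2 * t ≤ t₁) (hJ : closedBall y t ⊆ J) (hρ : 0 < ρ)
    (hε : 0 < ε) (hz : ∃ z ∈ closedBall y t, ρ ≤ V.covol (A z)) :
    μ {x | x ∈ closedBall y t ∧ V.covol (A x) < ε} ≤
      ENNReal.ofReal (D * 2 ^ L * 2 ^ α * (2 * B * ε / ρ) ^ (α / L) * t ^ α) := by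
  obtain ⟨z, hz, hρz⟩ := hz
  obtain ⟨σ, hσ⟩ : ∃ σ, ρ ≤ |plucker (fun j => A z *ᵥ toReal V.basis j) σ| := by
    by_contra! hcon
    exact absurd hρz (not_le.2 ((pi_norm_lt_iff hρ).2 hcon))
  refine (measure_mono fun x hx => ?_).trans
    (measure_sublevel_le hD hα hup hL hB (hV σ) ht ht₁ hJ hρ hε ⟨z, hz, hσ⟩)
  exact ⟨hx.1, (norm_le_pi_norm (plucker fun j => A x *ᵥ toReal V.basis j) σ).trans_lt hx.2⟩

theorem RatSubspace.continuousAt_covol {N : ℕ} {A : ℝ → Matrix (Fin N) (Fin N) ℝ} {x : ℝ}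
    (hA : ContinuousAt A x) (V : RatSubspace N) : ContinuousAt (fun t => V.covol (A t)) x := by
  have h : Continuous fun M : Matrix (Fin N) (Fin N) ℝ => V.covol M := by
    refine continuous_norm.comp (continuous_pi fun σ => Continuous.matrix_det ?_)
    refine continuous_matrix fun i j => ?_
    simp only [Matrix.of_apply, Matrix.mulVec, dotProduct]
    fun_prop
  exact h.continuousAt.comp hA

/-- A ball with arbitrary centre either misses the support, hence is null, or sits in a ball of
twice the radius about a support point; this costs the factor `2 ^ α` and half of `ρ₀`. -/
theorem IsAhlforsRegular.exists_bounds {μ : Measure ℝ} {C α : ℝ} (h : IsAhlforsRegular μ C α) :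
    ∃ D t₁ : ℝ, 0 < D ∧ 0 < t₁ ∧
      (∀ x ∈ μ.support, ∀ t, 0 < t → t ≤ t₁ →
        ENNReal.ofReal (t ^ α) ≤ ENNReal.ofReal D * μ (closedBall x t)) ∧
      ∀ y t, 0 < t → t ≤ t₁ → μ (closedBall y t) ≤ ENNReal.ofReal (D * t ^ α) := by
  obtain ⟨hC, hα, ρ₀, hρ₀, H⟩ := h
  have hC0 : 0 < C := by linarith
  have h2 : (1 : ℝ) ≤ 2 ^ α := Real.one_le_rpow (by norm_num) hα.le
  refine ⟨C * 2 ^ α, ρ₀ / 2, by positivity, by positivity, fun x hx t ht ht₁ => ?_,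
    fun y t ht ht₁ => ?_⟩
  · have h1 := (H x hx t ht (by linarith)).1
    calc ENNReal.ofReal (t ^ α) = ENNReal.ofReal C * ENNReal.ofReal (C⁻¹ * t ^ α) := by
          rw [← ENNReal.ofReal_mul hC0.le, mul_inv_cancel_left₀ hC0.ne']
      _ ≤ ENNReal.ofReal (C * 2 ^ α) * μ (closedBall x t) :=
          mul_le_mul' (ENNReal.ofReal_le_ofReal (le_mul_of_one_le_right hC0.le h2)) h1
  · rcases (closedBall y t ∩ μ.support).eq_empty_or_nonempty with h0 | ⟨w, hw, hws⟩
    · have hsub : closedBall y t ⊆ μ.supportᶜ := fun x hx hxs => by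
        have : x ∈ closedBall y t ∩ μ.support := ⟨hx, hxs⟩
        rw [h0] at this
        exact this
      rw [measure_mono_null hsub Measure.measure_compl_support]
      exact zero_le
    · have hsub : closedBall y t ⊆ closedBall w (2 * t) := by
        refine closedBall_subset_closedBall' ?_
        rw [mem_closedBall'] at hw
        linarith
      refine (measure_mono hsub).trans (((H w hws (2 * t) (by linarith) (by linarith)).2).trans ?_)
      rw [Real.mul_rpow (by norm_num) ht.le, mul_assoc]

theorem RatSubspace.exists_uniform_covol_lower_bound {m : ℕ}
    {A : ℝ → Matrix (Fin (m + 2)) (Fin (m + 2)) ℝ} {U O : Set ℝ} (hU : IsPreconnected U)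
    (hO : IsOpen O) (hOU : O ⊆ U) (hne : O.Nonempty) (hdet : ∀ x, (A x).det = 1)
    (hrow : ∀ q, AnalyticOnNhd ℝ (fun t => (A t *ᵥ q) 0) U)
    (hder : ∀ x ∈ O, ∀ q, HasDerivAt (fun t => (A t *ᵥ q) 0) ((A x *ᵥ q) 1) x)
    (hind : ∀ q, (∀ x ∈ U, (A x *ᵥ q) 0 = 0) → q = 0) :
    ∃ ρ, 0 < ρ ∧ ρ ≤ 1 ∧ ∀ (V : RatSubspace (m + 2)) (τ : Fin (m + 2) → ℝ), ∑ i, τ i = 0 →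
      0 < τ 0 → (∀ i : Fin (m + 2), 2 ≤ (i : ℕ) → τ i < 0) →
        ∃ x ∈ O, ρ ≤ V.covol (Matrix.diagonal (fun i => Real.exp (τ i)) * A x) := by
  have H := fun k : ℕ => exists_uniform_plucker_lower_bound hU hO hOU hne hdet hrow hder hind
    (k := k + 1) k.succ_pos
  choose r hr H using H
  have hne' : (Finset.range (m + 3)).Nonempty := ⟨0, by simp⟩
  refine ⟨min 1 ((Finset.range (m + 3)).inf' hne' r), lt_min one_pos
    ((Finset.lt_inf'_iff hne').2 fun k _ => hr k), min_le_left _ _, fun V τ hτ h0 hneg => ?_⟩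
  obtain ⟨k, hk⟩ : ∃ k, V.dim = k + 1 := Nat.exists_eq_succ_of_ne_zero V.dim_pos.ne'
  have hkm := V.dim_le
  have hmin : min 1 ((Finset.range (m + 3)).inf' hne' r) ≤ r k :=
    (min_le_right _ _).trans (Finset.inf'_le _ (by simp; omega))
  have key : ∀ (d : ℕ) (w : Fin d → Fin (m + 2) → ℤ), d = k + 1 →
      LinearIndependent ℝ (toReal w) → ∃ x ∈ O, ∃ σ : Fin d → Fin (m + 2), IsExpanding σ ∧
        r k ≤ |plucker (fun j => A x *ᵥ toReal w j) σ| := by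
    rintro d w rfl hw
    exact H k w hw
  obtain ⟨x, hx, σ, hσ, hle⟩ := key _ V.basis hk V.basis_spec.1.1
  refine ⟨x, hx, hmin.trans (hle.trans ?_)⟩
  refine le_trans ?_ (norm_le_pi_norm (plucker fun j =>
    (Matrix.diagonal (fun i => Real.exp (τ i)) * A x) *ᵥ toReal V.basis j) σ)
  simp only [← Matrix.mulVec_mulVec, plucker_diagonal]
  rw [norm_mul, ← Real.exp_sum, Real.norm_eq_abs, Real.norm_eq_abs, Real.abs_exp]
  exact le_mul_of_one_le_left (abs_nonneg _) (Real.one_le_exp (hσ τ hτ h0 hneg))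

theorem exists_nondivergence_estimate {m : ℕ} {A : ℝ → Matrix (Fin (m + 2)) (Fin (m + 2)) ℝ}
    {U : Set ℝ} (hU : IsOpen U) (hUc : IsPreconnected U) {x₀ : ℝ} (hx₀ : x₀ ∈ U)
    {μ : Measure ℝ} {C α : ℝ} (hμ : IsAhlforsRegular μ C α)
    (hA : ∀ i j, AnalyticOnNhd ℝ (fun x => A x i j) U) (hdet : ∀ x, (A x).det = 1)
    (hind : ∀ q, (∀ x ∈ U, (A x *ᵥ q) 0 = 0) → q = 0) :
    ∃ l₀ : ℝ, 0 < l₀ ∧ ∀ l : ℝ, 0 < l → l ≤ l₀ →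
      (∀ x ∈ ball x₀ (l / 2), ∀ q, HasDerivAt (fun t => (A t *ᵥ q) 0) ((A x *ᵥ q) 1) x) →
      ∃ M γ : ℝ, 0 < M ∧ 0 < γ ∧ ∀ δ : ℝ, 0 < δ → ∀ τ : Fin (m + 2) → ℝ, ∑ i, τ i = 0 →
        0 < τ 0 → (∀ i : Fin (m + 2), 2 ≤ (i : ℕ) → τ i < 0) →
        μ {x | x ∈ closedBall x₀ (l / 2) ∧ ∃ v : Fin (m + 2) → ℤ, v ≠ 0 ∧
          ‖(Matrix.diagonal (fun i => Real.exp (τ i)) * A x) *ᵥ fun i => (v i : ℝ)‖ < δ} ≤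
            ENNReal.ofReal (M * δ ^ γ) := by
  have hα : 0 < α := hμ.2.1
  obtain ⟨D, t₁, hD, ht₁, hlow, hup⟩ := hμ.exists_bounds
  obtain ⟨R, hR, L, B, hL, hB, hsep⟩ := exists_sublevelSeparated_plucker
    (A := A) (x₀ := x₀) fun i j => hA i j x₀ hx₀
  obtain ⟨R₁, hR₁, hRU⟩ := Metric.isOpen_iff.1 hU x₀ hx₀
  have hrow : ∀ q, AnalyticOnNhd ℝ (fun t => (A t *ᵥ q) 0) U := fun q => by
    simp only [Matrix.mulVec, dotProduct]
    exact Finset.analyticOnNhd_fun_sum _ fun i _ => (hA 0 i).mul analyticOnNhd_const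
  set R' := min R R₁ with hR'
  have hR'0 : 0 < R' := lt_min hR hR₁
  have h5 : (0 : ℝ) < 5 ^ (m + 2) := by positivity
  have h5' : (1 : ℝ) ≤ 5 ^ (m + 2) := one_le_pow₀ (by norm_num)
  -- The covering argument starts from the empty flag and has `m + 2` steps, each enlarging radii by
  -- a factor of at most 5.
  refine ⟨min t₁ R' / 5 ^ (m + 2), by positivity, fun l hl hle hder => ?_⟩
  rw [le_div_iff₀ h5] at hle
  set r := l / 2 with hr
  have hr0 : 0 < r := by positivity
  have hr1 : 2 * (5 ^ (m + 2) * r) ≤ t₁ := by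
    have := hle.trans (min_le_left _ _)
    rw [hr]; linarith
  have hr2 : 5 ^ (m + 2) * r < R' := by
    have := hle.trans (min_le_right _ _)
    rw [hr]; linarith
  have hr5 : r ≤ 5 ^ (m + 2) * r := le_mul_of_one_le_left hr0.le h5'
  have hballU : ball x₀ R' ⊆ U := (ball_subset_ball (min_le_right _ _)).trans hRU
  obtain ⟨ρ, hρ0, hρ1, hρ⟩ := RatSubspace.exists_uniform_covol_lower_bound hUc isOpen_ball
    ((ball_subset_ball (by linarith)).trans hballU) ⟨x₀, mem_ball_self hr0⟩ hdet hrow hder hind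
  have hL0 : (0 : ℝ) < L := by exact_mod_cast hL
  set γ := α / L with hγ
  have hγ0 : 0 < γ := by positivity
  set n : ℝ := ((m + 2 : ℕ) : ℝ) with hn
  have hn0 : 0 < n := by positivity
  set K := unmarkedConst D α (m + 2) with hK
  have hK0 : 0 ≤ K := unmarkedConst_nonneg hD _
  -- The first summand serves `n * δ ≤ ρ`; the second absorbs the trivial bound by the measure of
  -- the whole ball when `n * δ > ρ`.
  refine ⟨K * (D * 2 ^ L * 2 ^ α * (2 * B * n / ρ) ^ γ) * r ^ α + D * r ^ α * (n / ρ) ^ γ, γ,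
    by positivity, hγ0, fun δ hδ τ hτ hτ0 hτneg => ?_⟩
  set S : Set ℝ := {x | x ∈ closedBall x₀ r ∧ ∃ v : Fin (m + 2) → ℤ, v ≠ 0 ∧
          ‖(Matrix.diagonal (fun i => Real.exp (τ i)) * A x) *ᵥ fun i => (v i : ℝ)‖ < δ} with hS
  rw [add_mul, ENNReal.ofReal_add (by positivity) (by positivity)]
  rcases lt_or_ge ρ (n * δ) with hcase | hcase
  · refine le_add_left ((measure_mono fun x hx => hx.1).trans
      ((hup x₀ r hr0 (by linarith)).trans (ENNReal.ofReal_le_ofReal ?_)))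
    rw [mul_assoc (D * r ^ α), ← Real.mul_rpow (by positivity) hδ.le]
    refine le_mul_of_one_le_right (by positivity) (Real.one_le_rpow ?_ hγ0.le)
    rw [div_mul_eq_mul_div, one_le_div hρ0]
    exact hcase.le
  · refine le_add_right ?_
    set p : RatSubspace (m + 2) → ℝ → ℝ := fun V x =>
      V.covol (Matrix.diagonal (fun i => Real.exp (τ i)) * A x) with hp
    have hcont : ∀ V, ∀ x ∈ ball x₀ R', ContinuousAt (p V) x := fun V x hx => by
      refine V.continuousAt_covol (A := fun x => Matrix.diagonal (fun i => Real.exp (τ i)) * A x) ?_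
      have hAx : ContinuousAt A x := continuousAt_pi.2 fun i => continuousAt_pi.2 fun j =>
        (hA i j x (hballU hx)).continuousAt
      exact (Continuous.matrix_mul continuous_const continuous_id).continuousAt.comp hAx
    have hε : 0 < n * δ := by positivity
    -- For the empty flag every rational subspace is compatible, so `hρ` supplies the starting
    -- hypothesis.
    have hmain := measure_unmarked_le (μ := μ) (X := μ.support) (J := ball x₀ R') (p := p)
      (ε := n * δ) (ρ := ρ) (η := D * 2 ^ L * 2 ^ α * (2 * B * (n * δ) / ρ) ^ γ) (N := m + 2)
      hD (by positivity) hlow hup RatSubspace.card_le_of_isChain hcont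
      (fun V y t ht ht₁ hJ hz => V.measure_covol_lt_le hD hα hup hL hB
        (A := fun x => Matrix.diagonal (fun i => Real.exp (τ i)) * A x)
        (fun σ => (hsep V _ σ).mono (ball_subset_ball (min_le_left _ _)) le_rfl le_rfl)
        ht ht₁ hJ hρ0 hε hz)
      (m + 2) ∅ (by simp) (by simp) x₀ r hr0 hr1 (closedBall_subset_ball hr2)
      (fun V _ => by
        obtain ⟨x, hx, h⟩ := hρ V τ hτ hτ0 hτneg
        exact ⟨x, ball_subset_closedBall hx, h⟩)
    have hsub : S ∩ μ.support ⊆ {x | (x ∈ closedBall x₀ r ∧ x ∈ μ.support) ∧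
        (∀ V ∈ (∅ : Finset (RatSubspace (m + 2))), n * δ ≤ p V x ∧ p V x ≤ ρ) ∧
          ¬ IsMarked p (n * δ) ρ x} := by
      rintro x ⟨⟨hxb, v, hv, hlt⟩, hxs⟩
      refine ⟨⟨hxb, hxs⟩, by simp, ?_⟩
      rintro ⟨F, hF, hFp, hFc⟩
      have := norm_mulVec_ge_of_marked hcase hρ1 hF hFp hFc hv
      exact absurd hlt (not_lt.2 (le_of_mul_le_mul_left this hn0))
    calc μ S ≤ μ (S ∩ μ.support) + μ (S \ μ.support) := measure_le_inter_add_sdiff _ _ _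
      _ = μ (S ∩ μ.support) := by
        have h0 : μ (S \ μ.support) = 0 :=
          measure_mono_null (fun x hx => hx.2) (Measure.measure_compl_support (μ := μ))
        rw [h0, add_zero]
      _ ≤ _ := (measure_mono hsub).trans hmain
      _ = _ := by
        congr 1
        have e : 2 * B * (n * δ) / ρ = 2 * B * n / ρ * δ := by ring
        rw [e, Real.mul_rpow (by positivity) hδ.le]
        ring

/-! ### The matrices z(x)u(φ(x)) and the conclusion. -/

theorem u_mulVec_zero {n : ℕ} (y : Fin n → ℝ) (q : Fin (n + 1) → ℝ) :
    ((u y).1 *ᵥ q) 0 = ∑ i, (Fin.cons 1 y : Fin (n + 1) → ℝ) i * q i := by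
  simp [u, Matrix.mulVec, dotProduct]

theorem u_mulVec_of_ne_zero {n : ℕ} (y : Fin n → ℝ) (q : Fin (n + 1) → ℝ) {i : Fin (n + 1)}
    (hi : i ≠ 0) : ((u y).1 *ᵥ q) i = q i := by
  simp [u, Matrix.mulVec, dotProduct, Matrix.updateRow_ne hi, Matrix.one_apply]

theorem u₁_mulVec_one {m : ℕ} (y : Fin m → ℝ) (q : Fin (m + 2) → ℝ) :
    ((u₁ y).1 *ᵥ q) 1 = q 1 + ∑ j : Fin m, y j * q j.succ.succ := by
  simp [u₁, Matrix.mulVec, dotProduct, Fin.sum_univ_succ]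

theorem u₁_mulVec_of_ne_one {m : ℕ} (y : Fin m → ℝ) (q : Fin (m + 2) → ℝ) {i : Fin (m + 2)}
    (hi : i ≠ 1) : ((u₁ y).1 *ᵥ q) i = q i := by
  simp [u₁, Matrix.mulVec, dotProduct, Matrix.updateRow_ne hi, Matrix.one_apply]

theorem z_mul_u_mulVec_zero {m : ℕ} (φ : ℝ → Fin (m + 1) → ℝ) (x : ℝ) (q : Fin (m + 2) → ℝ) :
    ((z φ x * u (φ x)).1 *ᵥ q) 0 = ∑ i, (Fin.cons 1 (φ x) : Fin (m + 2) → ℝ) i * q i := by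
  rw [Matrix.SpecialLinearGroup.coe_mul, ← Matrix.mulVec_mulVec, z,
    u₁_mulVec_of_ne_one _ _ (by simp), u_mulVec_zero]

theorem z_mul_u_mulVec_one {m : ℕ} (φ : ℝ → Fin (m + 1) → ℝ) (x : ℝ) (q : Fin (m + 2) → ℝ) :
    ((z φ x * u (φ x)).1 *ᵥ q) 1 =
      q 1 + ∑ j : Fin m, deriv (fun t => φ t j.succ) x * q j.succ.succ := by
  rw [Matrix.SpecialLinearGroup.coe_mul, ← Matrix.mulVec_mulVec, z, u₁_mulVec_one,
    u_mulVec_of_ne_zero _ _ (by simp)]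
  congr 1
  exact Finset.sum_congr rfl fun j _ => by
    rw [u_mulVec_of_ne_zero _ _ (Fin.succ_ne_zero _), ψ]

theorem analyticOnNhd_apply {n : ℕ} {φ : ℝ → Fin n → ℝ} {U : Set ℝ} (hφ : AnalyticOnNhd ℝ φ U)
    (j : Fin n) : AnalyticOnNhd ℝ (fun t => φ t j) U := fun x hx =>
  ((ContinuousLinearMap.proj (R := ℝ) (φ := fun _ : Fin n => ℝ) j).analyticAt _).comp (hφ x hx)

theorem analyticOnNhd_updateRow_one {k : ℕ} {U : Set ℝ} (i₀ : Fin k) {r : ℝ → Fin k → ℝ}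
    (hr : ∀ j, AnalyticOnNhd ℝ (fun x => r x j) U) (i j : Fin k) :
    AnalyticOnNhd ℝ
      (fun x => (1 : Matrix (Fin k) (Fin k) ℝ).updateRow i₀ (r x) i j) U := by
  by_cases hi : i = i₀
  · simpa [hi] using hr j
  · simpa [Matrix.updateRow_ne hi] using analyticOnNhd_const

theorem analyticOnNhd_z_mul_u {m : ℕ} {φ : ℝ → Fin (m + 1) → ℝ} {U : Set ℝ}
    (hφ : AnalyticOnNhd ℝ φ U) (i j : Fin (m + 2)) :
    AnalyticOnNhd ℝ (fun x => (z φ x * u (φ x)).1 i j) U := by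
  simp only [Matrix.SpecialLinearGroup.coe_mul, Matrix.mul_apply]
  refine Finset.analyticOnNhd_fun_sum _ fun l _ => AnalyticOnNhd.mul ?_ ?_
  · refine analyticOnNhd_updateRow_one 1 (fun c => ?_) i l
    refine Fin.cases ?_ (fun c => Fin.cases ?_ (fun c => ?_) c) c
    · simpa using analyticOnNhd_const
    · simpa using analyticOnNhd_const
    · simpa [ψ] using (analyticOnNhd_apply hφ c.succ).deriv
  · refine analyticOnNhd_updateRow_one 0 (fun c => ?_) l j
    refine Fin.cases ?_ (fun c => ?_) c
    · simpa using analyticOnNhd_const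
    · simpa using analyticOnNhd_apply hφ c

/-- This is the purpose of `z`: the second row (0, 1, φ₂', …, φₙ') of the product is the derivative
of its first row (1, φ₁, …, φₙ) wherever φ₁ is locally the identity. -/
theorem hasDerivAt_z_mul_u {m : ℕ} {φ : ℝ → Fin (m + 1) → ℝ} {x : ℝ} (hφ : AnalyticAt ℝ φ x)
    (h0 : ∀ᶠ t in 𝓝 x, φ t 0 = t) (q : Fin (m + 2) → ℝ) :
    HasDerivAt (fun t => ((z φ t * u (φ t)).1 *ᵥ q) 0) (((z φ x * u (φ x)).1 *ᵥ q) 1) x := by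
  simp only [z_mul_u_mulVec_zero, z_mul_u_mulVec_one, Fin.sum_univ_succ, Fin.cons_zero,
    Fin.cons_succ, one_mul]
  have hd : ∀ j, HasDerivAt (fun t => φ t j) (deriv (fun t => φ t j) x) x := fun j =>
    (((ContinuousLinearMap.proj (R := ℝ) (φ := fun _ : Fin (m + 1) => ℝ) j).analyticAt _).comp
      hφ).differentiableAt.hasDerivAt
  have h1 : HasDerivAt (fun t => φ t 0) 1 x := (hasDerivAt_id x).congr_of_eventuallyEq h0
  have h2 := ((h1.mul_const (q 1)).add (HasDerivAt.fun_sum fun (j : Fin m) (_ : j ∈ Finset.univ) =>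
    (hd j.succ).mul_const (q j.succ.succ))).const_add (q 0)
  simpa using h2

theorem eq_zero_of_isNondegenerate {m : ℕ} {φ : ℝ → Fin (m + 1) → ℝ} {U : Set ℝ}
    (hnd : IsNondegenerate U φ) (q : Fin (m + 2) → ℝ)
    (h : ∀ x ∈ U, ((z φ x * u (φ x)).1 *ᵥ q) 0 = 0) : q = 0 := by
  funext i
  refine Fintype.linearIndependent_iff.1 hnd q ?_ i
  funext x
  have := h x x.2
  rw [z_mul_u_mulVec_zero] at this
  simpa [Finset.sum_apply, mul_comm] using this

theorem W_subset {m : ℕ} (φ : ℝ → Fin (m + 1) → ℝ) (τ : Fin (m + 2) → ℝ) (hτ : ∑ i, τ i = 0)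
    (J : Set ℝ) (δ : ℝ) :
    W φ τ hτ J δ ⊆ {x | x ∈ J ∧ ∃ v : Fin (m + 2) → ℤ, v ≠ 0 ∧
      ‖(Matrix.diagonal (fun i => Real.exp (τ i)) * (z φ x * u (φ x)).1) *ᵥ
        fun i => (v i : ℝ)‖ < δ} := by
  rintro x ⟨hx, hK⟩
  refine ⟨hx, ?_⟩
  by_contra! hcon
  refine hK ⟨⟨_, rfl⟩, ?_⟩
  rintro _ ⟨v, rfl⟩ hv0
  have hv : v ≠ 0 := by
    rintro rfl
    apply hv0
    ext i
    simp [Matrix.mulVec, dotProduct]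
  refine (hcon v hv).trans ?_
  refine (pi_norm_le_iff_of_nonneg (norm_nonneg _)).2 fun i => ?_
  -- The sup norm is at most the Euclidean norm, so a Euclidean-short vector is also sup-short.
  refine le_trans (le_of_eq ?_) (PiLp.norm_apply_le (p := 2) _ i)
  have e : (g τ hτ * z φ x * u (φ x)).1 =
      Matrix.diagonal (fun i => Real.exp (τ i)) * (z φ x * u (φ x)).1 := by
    rw [mul_assoc]
    rfl
  rw [← e]

end FractalQnD

end

theorem mainTheorem6 (m : ℕ) (U : Set ℝ) (hU : IsOpen U) (hUint : U.OrdConnected)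
    (C α : ℝ) (μ : MeasureTheory.Measure ℝ) (hμ : FractalQnD.IsAhlforsRegular μ C α)
    (φ : ℝ → Fin (m + 1) → ℝ) (hφ : AnalyticOnNhd ℝ φ U) (hnd : FractalQnD.IsNondegenerate U φ)
    (x₀ : ℝ) (hx₀ : x₀ ∈ μ.support ∩ U) :
    ∃ l₀ : ℝ, 0 < l₀ ∧ ∀ l : ℝ, 0 < l → l ≤ l₀ →
      FractalQnD.centredInterval x₀ (3 ^ (m + 2) * l) ⊆ U →
      (∀ x ∈ FractalQnD.centredInterval x₀ (3 ^ (m + 2) * l), φ x 0 = x) →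
      ∃ M γ : ℝ, 0 < M ∧ 0 < γ ∧
        ∀ δ : ℝ, 0 < δ → ∀ (τ : Fin (m + 2) → ℝ) (hτ : ∑ i, τ i = 0),
          0 < τ 0 → (∀ i : Fin (m + 2), 2 ≤ (i : ℕ) → τ i < 0) →
          μ (FractalQnD.W φ τ hτ (FractalQnD.centredInterval x₀ l) δ) ≤
            ENNReal.ofReal (M * δ ^ γ) := by
  obtain ⟨l₀, hl₀, H⟩ := FractalQnD.exists_nondivergence_estimate
    (A := fun x => (FractalQnD.z φ x * FractalQnD.u (φ x)).1) hU hUint.isPreconnected hx₀.2 hμ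
    (FractalQnD.analyticOnNhd_z_mul_u hφ) (fun x => (FractalQnD.z φ x * FractalQnD.u (φ x)).2)
    (FractalQnD.eq_zero_of_isNondegenerate hnd)
  refine ⟨l₀, hl₀, fun l hl hle hsub hφ0 => ?_⟩
  have hball : ∀ x ∈ Metric.ball x₀ (l / 2),
      x ∈ FractalQnD.centredInterval x₀ (3 ^ (m + 2) * l) := fun x hx => by
    have h3 : l ≤ 3 ^ (m + 2) * l :=
      le_mul_of_one_le_left hl.le (one_le_pow₀ (by norm_num))
    rw [Real.ball_eq_Ioo] at hx
    exact ⟨by linarith [hx.1], by linarith [hx.2]⟩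
  obtain ⟨M, γ, hM, hγ, hest⟩ := H l hl hle fun x hx q =>
    FractalQnD.hasDerivAt_z_mul_u (hφ x (hsub (hball x hx)))
      (Filter.eventually_of_mem (Metric.isOpen_ball.mem_nhds hx) fun t ht => hφ0 t (hball t ht)) q
  refine ⟨M, γ, hM, hγ, fun δ hδ τ hτ hτ0 hτneg => ?_⟩
  refine (MeasureTheory.measure_mono (FractalQnD.W_subset φ τ hτ _ δ)).trans ?_
  rw [FractalQnD.centredInterval, ← Real.closedBall_eq_Icc]
  exact hest δ hδ τ hτ hτ0 hτneg
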